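/- Let $n\ge 1$, $0<\alpha<2$ and $r>0$. For $\phi\in C_0^\infty(\mathbb{R}^n)$ put $$(-\Delta)^{\alpha/2}\phi(x)=C_{n,\alpha}\lim_{\varepsilon\to0^+}\int_{\mathbb{R}^n\setminus B_\varepsilon(x)}\frac{\phi(x)-\phi(z)}{|x-z|^{n+\alpha}}\,dz,\qquad C_{n,\alpha}=\frac{\alpha\,2^{\alpha-1}\,\Gamma(\frac{n+\alpha}{2})}{\pi^{n/2}\,\Gamma(1-\frac{\alpha}{2})},$$ and let $L_\alpha$ be the space of measurable $u:\mathbb{R}^n\to\mathbb{R}$ with $\int_{\mathbb{R}^n}\frac{|u(x)|}{1+|x|^{n+\alpha}}\,dx<\infty$. A function $u$ is called $\alpha$-harmonic in an open set $\Omega\subseteq\mathbb{R}^n$ if $u\in L_\alpha$ and $\int_{\mathbb{R}^n}u\,(-\Delta)^{\alpha/2}\phi\,dx=0$ for all $\phi\in C_0^\infty(\Omega)$, and $\alpha$-harmonic if this holds with $\Omega=\mathbb{R}^n$. For $|x|<r$ let $$P_r(y,x)=\frac{\Gamma(n/2)}{\pi^{\frac n2+1}}\sin\frac{\pi\alpha}{2}\left[\frac{r^2-|x|^2}{|y|^2-r^2}\right]^{\alpha/2}\frac{1}{|x-y|^n}\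 \text{ for } |y|>r,\qquad P_r(y,x)=0\ \text{ for } |y|\le r.$$ **Theorem.** Let $u\in L_\alpha$ be $\alpha$-harmonic. Then for every $x$ with $|x|<r$ the integral $\int_{|y|>r}P_r(y,x)u(y)\,dy$ converges absolutely, and the function $$\hat u(x)=\begin{cases}\int_{|y|>r}P_r(y,x)\,u(y)\,dy,&|x|<r,\\ u(x),&|x|\ge r,\end{cases}$$ is $\alpha$-harmonic in $B_r(0)$; also pointwise, for every $|x|<r$, the integral $\int_{\mathbb{R}^n\setminus B_\varepsilon(x)}\frac{\hat u(x)-\hat u(z)}{|x-z|^{n+\alpha}}\,dz$ converges absolutely for every $\varepsilon>0$ and tends to $0$ as $\varepsilon\to0^+$, i.e. $(-\Delta)^{\alpha/2}\hat u(x)=0$. Moreover the Poisson representation $$u(x)=\int_{|y|>r}P_r(y,x)\,u(y)\,dy$$ holds for almost every $x$ with $|x|<r$, and for every $x$ with $|x|<r$ at which $u$ is continuous. -/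

import Mathlib

open MeasureTheory Filter Topology
open scoped ContDiff

noncomputable section

/-- The space `L_α` of measurable `u : ℝⁿ → ℝ` with `∫ |u(x)| / (1 + |x|^(n+α)) dx < ∞`. -/
def MemLAlpha {n : ℕ} (α : ℝ) (u : EuclideanSpace ℝ (Fin n) → ℝ) : Prop :=
  AEStronglyMeasurable u volume ∧
    Integrable (fun x => |u x| / (1 + ‖x‖ ^ ((n : ℝ) + α))) volume

/-- The normalizing constant `C_{n,α} = α 2^(α-1) Γ((n+α)/2) / (π^(n/2) Γ(1-α/2))`, for which the
fractional Laplacian has Fourier symbol `|ξ|^α`. -/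
def fracLaplacianConst (n : ℕ) (α : ℝ) : ℝ :=
  α * (2 : ℝ) ^ (α - 1) * Real.Gamma (((n : ℝ) + α) / 2) /
    (Real.pi ^ ((n : ℝ) / 2) * Real.Gamma (1 - α / 2))

/-- `C_{n,α} ∫_{ℝⁿ \ B_ε(x)} (u(x) - u(z)) / |x - z|^(n+α) dz`. -/
def truncFracLaplacian {n : ℕ} (α : ℝ) (u : EuclideanSpace ℝ (Fin n) → ℝ)
    (x : EuclideanSpace ℝ (Fin n)) (ε : ℝ) : ℝ :=
  fracLaplacianConst n α *
    ∫ z in (Metric.ball x ε)ᶜ, (u x - u z) / ‖x - z‖ ^ ((n : ℝ) + α)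

/-- The fractional Laplacian `(-Δ)^(α/2) u (x)`, as the limit of the truncated integrals when
`ε → 0⁺`. It is used for smooth compactly supported `u`, for which the limit exists. -/
def fracLaplacian {n : ℕ} (α : ℝ) (u : EuclideanSpace ℝ (Fin n) → ℝ)
    (x : EuclideanSpace ℝ (Fin n)) : ℝ :=
  limUnder (𝓝[>] (0 : ℝ)) (truncFracLaplacian α u x)

/-- `(-Δ)^(α/2) u (x)` exists pointwise and equals `v`: the truncated integrals converge absolutely
and tend to `v` as `ε → 0⁺`. -/
def HasFracLaplacianAt {n : ℕ} (α : ℝ) (u : EuclideanSpace ℝ (Fin n) → ℝ)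
    (x : EuclideanSpace ℝ (Fin n)) (v : ℝ) : Prop :=
  (∀ ε > 0, IntegrableOn (fun z => (u x - u z) / ‖x - z‖ ^ ((n : ℝ) + α))
    (Metric.ball x ε)ᶜ volume) ∧
  Tendsto (truncFracLaplacian α u x) (𝓝[>] (0 : ℝ)) (𝓝 v)

theorem HasFracLaplacianAt.fracLaplacian_eq {n : ℕ} {α : ℝ} {u : EuclideanSpace ℝ (Fin n) → ℝ}
    {x : EuclideanSpace ℝ (Fin n)} {v : ℝ} (h : HasFracLaplacianAt α u x v) :
    fracLaplacian α u x = v :=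
  h.2.limUnder_eq

/-- `u` is `α`-harmonic in the open set `Ω`: `u ∈ L_α` and `(-Δ)^(α/2) u = 0` in `Ω` in the sense of
distributions, that is `∫ u (-Δ)^(α/2) φ = 0` for all `φ ∈ C_0^∞(Ω)`. -/
def IsAlphaHarmonicOn {n : ℕ} (α : ℝ) (u : EuclideanSpace ℝ (Fin n) → ℝ)
    (Ω : Set (EuclideanSpace ℝ (Fin n))) : Prop :=
  MemLAlpha α u ∧
    ∀ φ : EuclideanSpace ℝ (Fin n) → ℝ, ContDiff ℝ ∞ φ → HasCompactSupport φ → tsupport φ ⊆ Ω →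
      ∫ x, u x * fracLaplacian α φ x = 0

/-- `u` is `α`-harmonic (in all of `ℝⁿ`, in the sense of distributions). -/
def IsAlphaHarmonic {n : ℕ} (α : ℝ) (u : EuclideanSpace ℝ (Fin n) → ℝ) : Prop :=
  IsAlphaHarmonicOn α u Set.univ

/-- The fractional Poisson kernel `P_r(y, x)` of the ball `B_r(0)`, for `|x| < r`. -/
def fracPoissonKernel {n : ℕ} (α r : ℝ) (y x : EuclideanSpace ℝ (Fin n)) : ℝ :=
  open Classical in
  if r < ‖y‖ then
    Real.Gamma ((n : ℝ) / 2) / Real.pi ^ ((n : ℝ) / 2 + 1) * Real.sin (Real.pi * α / 2) *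
      ((r ^ 2 - ‖x‖ ^ 2) / (‖y‖ ^ 2 - r ^ 2)) ^ (α / 2) * (1 / ‖x - y‖ ^ n)
  else 0

/-- The function `û`: the Poisson integral `∫_{|y|>r} P_r(y, x) u(y) dy` for `|x| < r`, and `u(x)`
for `|x| ≥ r`. -/
def fracPoissonExtension {n : ℕ} (α r : ℝ) (u : EuclideanSpace ℝ (Fin n) → ℝ)
    (x : EuclideanSpace ℝ (Fin n)) : ℝ :=
  open Classical in
  if ‖x‖ < r then ∫ y in {y | r < ‖y‖}, fracPoissonKernel α r y x * u y else u x

end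

/-!
The proof rests on a Liouville theorem: a function in `L_α` that is `α`-harmonic on the whole space
in the sense of distributions agrees almost everywhere with an affine function. Once this is known,
`û` is that affine function inside the ball and `u` outside, so everything follows from the fact
that the Poisson kernel reproduces affine functions, and from the vanishing, by reflection about
`x`, of the truncated integrals of an affine function.

*Liouville theorem* (`IsAlphaHarmonic.ae_eq_affine`). On functions with enough decay the fractional
Laplacian is a constant multiple of `∫ (2 f(x) - f(x + z) - f(x - z)) / |z|^(n + α) dz`. This is
`O(|x|^(-n - α))` with uniform constants, so cutting off extends the hypothesis from test functions
to Schwartz functions (`IsAlphaHarmonic.integral_mul_symFracLaplacian_eq_zero`). On the Fourier side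
the operator is multiplication by a positive multiple of `|ξ|^α` (`symFracLaplacian_fourierInv`,
`exists_fracSymbol_eq`), which can be divided out away from the origin. Hence `u` is orthogonal to
every function whose Fourier transform is a test function supported away from `0`. Let `K` be a
kernel whose Fourier transform is a bump function equal to `1` near `0`, and `K_R` its dilates at
scale `R`. Then `K_R - K_{R'}` is such a function, and so the low-frequency part
`v(x) = ∫ u(y) K_R(y - x) dy` does not depend on `R`. As `R → ∞` the second differences of `v` are
`O(R^(α - 2))`, thus zero, and `v`, being continuous, is affine; as `R → 0`, `v` converges to `u` as
a distribution. So `u = v` almost everywhere.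

*Poisson kernel* (`lintegral_fracPoissonKernel`, `integral_fracPoissonKernel_inner`). In polar
coordinates `y = x + tθ` about `x`, one has `|y|² - r² = t² + 2ct - A` with `c = ⟨x, θ⟩` and
`A = r² - |x|²`. After the substitution `B = t² + 2ct`, the measures `dt / t` on the rays in the
directions `θ` and `-θ` add up to `dB / B`, and the mass of the kernel becomes an Euler beta
integral. The first moment carries `dt = dB / (2 √(c² + B))`, which is even in `c`; the moments in
opposite directions cancel.
-/

/-! ### One-dimensional integrals along lines through an interior point -/

/-- Euler's integral `B(a, 1 - a)`, evaluated by the reflection formula for the Gamma function. -/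
theorem setLIntegral_betaKernel {a : ℝ} (ha : 0 < a) (ha1 : a < 1) :
    ∫⁻ w in Set.Ioo (0 : ℝ) 1, ENNReal.ofReal (w ^ (a - 1) * (1 - w) ^ (-a)) =
      ENNReal.ofReal (Real.pi / Real.sin (Real.pi * a)) := by
  have h1a : 0 < 1 - a := by linarith
  have hb := ProbabilityTheory.beta_pos ha h1a
  have hB : ProbabilityTheory.beta a (1 - a) = Real.pi / Real.sin (Real.pi * a) := by
    rw [ProbabilityTheory.beta, Real.Gamma_mul_Gamma_one_sub]; simp
  have h := ProbabilityTheory.lintegral_betaPDF_eq_one ha h1a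
  rw [ProbabilityTheory.lintegral_betaPDF] at h
  have h2 : ∀ w : ℝ, ENNReal.ofReal (w ^ (a - 1) * (1 - w) ^ (-a)) =
      ENNReal.ofReal (ProbabilityTheory.beta a (1 - a)) *
        ENNReal.ofReal (1 / ProbabilityTheory.beta a (1 - a) * w ^ (a - 1) *
          (1 - w) ^ (1 - a - 1)) := by
    intro w
    rw [← ENNReal.ofReal_mul hb.le]
    congr 1
    rw [show 1 - a - 1 = -a by ring]
    field_simp
  simp_rw [h2]
  rw [lintegral_const_mul' _ _ ENNReal.ofReal_ne_top, h, mul_one, hB]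

/-- Under `B = A / w` this is Euler's integral `B(a, 1 - a)`. -/
theorem setLIntegral_Ioi_kernel {a A : ℝ} (ha : 0 < a) (ha1 : a < 1) (hA : 0 < A) :
    ∫⁻ B in Set.Ioi A, ENNReal.ofReal ((A / (B - A)) ^ a / B) =
      ENNReal.ofReal (Real.pi / Real.sin (Real.pi * a)) := by
  have himg : (fun w : ℝ => A / w) '' Set.Ioo 0 1 = Set.Ioi A := by
    ext B
    simp only [Set.mem_image, Set.mem_Ioo, Set.mem_Ioi]
    constructor
    · rintro ⟨w, ⟨h0, h1⟩, rfl⟩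
      rw [lt_div_iff₀ h0]; nlinarith
    · intro hB
      have hB0 : 0 < B := hA.trans hB
      refine ⟨A / B, ⟨by positivity, (div_lt_one hB0).2 hB⟩, ?_⟩
      field_simp
  have hderiv : ∀ w ∈ Set.Ioo (0 : ℝ) 1,
      HasDerivWithinAt (fun w : ℝ => A / w) (-A / w ^ 2) (Set.Ioo 0 1) w := by
    intro w hw
    have h := ((hasDerivAt_const w A).div (hasDerivAt_id w) hw.1.ne').hasDerivWithinAt
      (s := Set.Ioo 0 1)
    exact h.congr_deriv (by simp)
  have hinj : Set.InjOn (fun w : ℝ => A / w) (Set.Ioo 0 1) := by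
    intro w hw v hv h
    have h' : A / w = A / v := h
    rw [div_eq_div_iff hw.1.ne' hv.1.ne'] at h'
    exact (mul_left_cancel₀ hA.ne' h').symm
  rw [← himg, lintegral_image_eq_lintegral_abs_deriv_mul measurableSet_Ioo hderiv hinj,
    ← setLIntegral_betaKernel ha ha1]
  refine setLIntegral_congr_fun measurableSet_Ioo fun w hw => ?_
  have h0 := hw.1
  have h1 : 0 < 1 - w := by linarith [hw.2]
  rw [← ENNReal.ofReal_mul (abs_nonneg _)]
  congr 1
  have e1 : A / (A / w - A) = w / (1 - w) := by
    have : A / w - A = A * (1 - w) / w := by field_simp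
    rw [this]; field_simp
  rw [e1, Real.div_rpow h0.le h1.le, Real.rpow_sub_one h0.ne', Real.rpow_neg h1.le,
    neg_div, abs_neg, abs_of_pos (by positivity)]
  have := Real.rpow_pos_of_pos h1 a
  field_simp

/-- The profile of the Poisson kernel along the ray `x + tθ`, `t > 0`, where `c = ⟨x, θ⟩` and
`A = r² - |x|²`: here `|x + tθ|² - r² = t² + 2ct - A`. -/
noncomputable def rayProfile (a A c t : ℝ) : ℝ :=
  open Classical in if A < t ^ 2 + 2 * c * t then (A / (t ^ 2 + 2 * c * t - A)) ^ a else 0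

/-- The substitution `B = t² + 2ct` on a ray. -/
theorem lintegral_rayProfile_mul {a A c : ℝ} (hA : 0 < A) (g : ℝ → ℝ) :
    ∫⁻ t in Set.Ioi (0 : ℝ), ENNReal.ofReal (rayProfile a A c t * g t) =
      ∫⁻ B in Set.Ioi A, ENNReal.ofReal ((A / (B - A)) ^ a *
        (g (-c + √(c ^ 2 + B)) / (2 * √(c ^ 2 + B)))) := by
  have himg : (fun B : ℝ => -c + √(c ^ 2 + B)) '' Set.Ioi A =
      Set.Ioi 0 ∩ {t | A < t ^ 2 + 2 * c * t} := by
    ext t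
    simp only [Set.mem_image, Set.mem_Ioi, Set.mem_inter_iff, Set.mem_ofPred_eq]
    constructor
    · rintro ⟨B, hB, rfl⟩
      have hs := Real.sq_sqrt (show 0 ≤ c ^ 2 + B by nlinarith)
      have hlt : c < √(c ^ 2 + B) := Real.lt_sqrt_of_sq_lt (by linarith)
      exact ⟨by linarith, by nlinarith⟩
    · rintro ⟨h0, h1⟩
      refine ⟨t ^ 2 + 2 * c * t, h1, ?_⟩
      have : c ^ 2 + (t ^ 2 + 2 * c * t) = (t + c) ^ 2 := by ring
      rw [this, Real.sqrt_sq (by nlinarith)]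
      ring
  have hderiv : ∀ B ∈ Set.Ioi A, HasDerivWithinAt (fun B : ℝ => -c + √(c ^ 2 + B))
      (1 / (2 * √(c ^ 2 + B))) (Set.Ioi A) B := by
    intro B hB
    have hB' : A < B := hB
    have h := (((hasDerivAt_id B).const_add (c ^ 2)).sqrt
      (by simp only [id]; nlinarith)).const_add (-c)
    exact h.hasDerivWithinAt
  have hinj : Set.InjOn (fun B : ℝ => -c + √(c ^ 2 + B)) (Set.Ioi A) := by
    intro B hB D hD h
    have hB' : A < B := hB
    have hD' : A < D := hD
    have h' : √(c ^ 2 + B) = √(c ^ 2 + D) := by simpa using h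
    rw [Real.sqrt_inj (by nlinarith) (by nlinarith)] at h'
    linarith
  have hmeas : MeasurableSet {t : ℝ | A < t ^ 2 + 2 * c * t} :=
    measurableSet_lt (by fun_prop) (by fun_prop)
  have h1 : ∫⁻ t in Set.Ioi (0 : ℝ), ENNReal.ofReal (rayProfile a A c t * g t) =
      ∫⁻ t in Set.Ioi 0 ∩ {t | A < t ^ 2 + 2 * c * t},
        ENNReal.ofReal ((A / (t ^ 2 + 2 * c * t - A)) ^ a * g t) := by
    rw [Set.inter_comm, ← Measure.restrict_restrict hmeas, ← lintegral_indicator hmeas]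
    refine lintegral_congr fun t => ?_
    by_cases ht : A < t ^ 2 + 2 * c * t
    · rw [Set.indicator_of_mem (by exact ht), rayProfile, if_pos ht]
    · rw [Set.indicator_of_notMem (by exact ht), rayProfile, if_neg ht]; simp
  rw [h1, ← himg,
    lintegral_image_eq_lintegral_abs_deriv_mul measurableSet_Ioi hderiv hinj]
  refine setLIntegral_congr_fun measurableSet_Ioi fun B hB => ?_
  have hB' : A < B := hB
  have hs := Real.sq_sqrt (show 0 ≤ c ^ 2 + B by nlinarith)
  have hp : 0 < √(c ^ 2 + B) := Real.sqrt_pos.2 (by nlinarith)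
  rw [← ENNReal.ofReal_mul (abs_nonneg _), abs_of_pos (by positivity)]
  congr 1
  have : (-c + √(c ^ 2 + B)) ^ 2 + 2 * c * (-c + √(c ^ 2 + B)) = B := by nlinarith
  rw [this]
  ring

/-- Summing over the two directions `θ` and `-θ` turns `dt / t` into `dB / B`. -/
theorem lintegral_rayProfile_add_neg {a A c : ℝ} (ha : 0 < a) (ha1 : a < 1) (hA : 0 < A) :
    (∫⁻ t in Set.Ioi (0 : ℝ), ENNReal.ofReal (rayProfile a A c t * t⁻¹)) +
      ∫⁻ t in Set.Ioi (0 : ℝ), ENNReal.ofReal (rayProfile a A (-c) t * t⁻¹) =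
      ENNReal.ofReal (Real.pi / Real.sin (Real.pi * a)) := by
  rw [lintegral_rayProfile_mul hA, lintegral_rayProfile_mul hA, ← lintegral_add_left (by fun_prop),
    ← setLIntegral_Ioi_kernel ha ha1 hA]
  refine setLIntegral_congr_fun measurableSet_Ioi fun B hB => ?_
  have hB' : A < B := hB
  have hs := Real.sq_sqrt (show 0 ≤ c ^ 2 + B by nlinarith)
  have hp : 0 < √(c ^ 2 + B) := Real.sqrt_pos.2 (by nlinarith)
  have h1 : c < √(c ^ 2 + B) := Real.lt_sqrt_of_sq_lt (by linarith)
  have h2 : -c < √(c ^ 2 + B) := Real.lt_sqrt_of_sq_lt (by nlinarith)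
  have hk : 0 ≤ (A / (B - A)) ^ a :=
    Real.rpow_nonneg (div_nonneg hA.le (by linarith)) _
  have hB0 : 0 < B := hA.trans hB'
  have p1 : 0 < -c + √(c ^ 2 + B) := by linarith
  have p2 : 0 < c + √(c ^ 2 + B) := by linarith
  simp only [neg_sq, neg_neg]
  rw [← ENNReal.ofReal_add (by positivity) (by positivity), ← mul_add, div_eq_mul_inv _ B]
  congr 2
  field_simp
  nlinarith

/-- The weight `dB / √(c² + B)` is even in `c`. -/
theorem lintegral_rayProfile_neg {a A c : ℝ} (hA : 0 < A) :
    ∫⁻ t in Set.Ioi (0 : ℝ), ENNReal.ofReal (rayProfile a A (-c) t) =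
      ∫⁻ t in Set.Ioi (0 : ℝ), ENNReal.ofReal (rayProfile a A c t) := by
  have h := fun c => lintegral_rayProfile_mul (a := a) (c := c) hA (fun _ => 1)
  simp only [mul_one] at h
  rw [h, h]
  simp only [neg_sq]

/-! ### Polar coordinates -/

/-- Integration in polar coordinates of a nonnegative function that need not be radial. -/
theorem lintegral_polar {E : Type*} [NormedAddCommGroup E] [NormedSpace ℝ E]
    [FiniteDimensional ℝ E] [Nontrivial E] [MeasurableSpace E] [BorelSpace E]
    (μ : Measure E) [μ.IsAddHaarMeasure] {f : E → ENNReal} (hf : Measurable f) :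
    ∫⁻ x, f x ∂μ = ∫⁻ θ, ∫⁻ t in Set.Ioi (0 : ℝ),
      ENNReal.ofReal (t ^ (Module.finrank ℝ E - 1)) * f (t • (θ : E)) ∂volume ∂μ.toSphere := by
  have h1 : ∫⁻ x, f x ∂μ = ∫⁻ x : ({(0)}ᶜ : Set E), f x.1 ∂(μ.comap (↑)) := by
    rw [lintegral_subtype_comap (measurableSet_singleton _).compl, restrict_compl_singleton]
  have h2 : ∫⁻ x : ({(0)}ᶜ : Set E), f x.1 ∂(μ.comap (↑)) =
      ∫⁻ p : Metric.sphere (0 : E) 1 × Set.Ioi (0 : ℝ), f ((p.2 : ℝ) • (p.1 : E))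
        ∂μ.toSphere.prod (.volumeIoiPow (Module.finrank ℝ E - 1)) := by
    rw [← μ.measurePreserving_homeomorphUnitSphereProd.lintegral_comp_emb
      (Homeomorph.measurableEmbedding _)]
    refine lintegral_congr fun x => ?_
    congr 1
    have hx : ‖(x : E)‖ ≠ 0 := norm_ne_zero_iff.2 x.2
    simp [smul_smul, hx]
  rw [h1, h2, lintegral_prod _ (by fun_prop)]
  refine lintegral_congr fun θ => ?_
  rw [Measure.volumeIoiPow, lintegral_withDensity_eq_lintegral_mul _ (by fun_prop) (by fun_prop),
    ← lintegral_subtype_comap measurableSet_Ioi]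
  rfl

/-! ### The Poisson kernel reproduces affine functions -/

/-- The constant of the Poisson kernel of a ball. -/
noncomputable def poissonConst (n : ℕ) (α : ℝ) : ℝ :=
  Real.Gamma ((n : ℝ) / 2) / Real.pi ^ ((n : ℝ) / 2 + 1) * Real.sin (Real.pi * α / 2)

theorem sin_pi_mul_half_pos {α : ℝ} (hα0 : 0 < α) (hα2 : α < 2) :
    0 < Real.sin (Real.pi * α / 2) :=
  Real.sin_pos_of_pos_of_lt_pi (by positivity) (by nlinarith [Real.pi_pos])

theorem poissonConst_nonneg {α : ℝ} (n : ℕ) (hα0 : 0 < α) (hα2 : α < 2) :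
    0 ≤ poissonConst n α := by
  have := (sin_pi_mul_half_pos hα0 hα2).le
  have : 0 ≤ Real.Gamma ((n : ℝ) / 2) := Real.Gamma_nonneg_of_nonneg (by positivity)
  unfold poissonConst
  positivity

section Poisson

variable {n : ℕ} {α r : ℝ} {x : EuclideanSpace ℝ (Fin n)}

theorem measurable_fracPoissonKernel (x : EuclideanSpace ℝ (Fin n)) :
    Measurable fun y => fracPoissonKernel α r y x := by
  classical
  unfold fracPoissonKernel
  exact Measurable.ite (measurableSet_lt (by fun_prop) (by fun_prop)) (by fun_prop) (by fun_prop)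

theorem fracPoissonKernel_nonneg (hα0 : 0 < α) (hα2 : α < 2) (hr : 0 < r) (hx : ‖x‖ < r)
    (y : EuclideanSpace ℝ (Fin n)) : 0 ≤ fracPoissonKernel α r y x := by
  have h := poissonConst_nonneg n hα0 hα2
  unfold poissonConst at h
  unfold fracPoissonKernel
  split_ifs with hy
  · refine mul_nonneg (mul_nonneg h (Real.rpow_nonneg (div_nonneg ?_ ?_) _)) (by positivity)
    · nlinarith [norm_nonneg x]
    · nlinarith
  · exact le_rfl

theorem fracPoissonKernel_ray (hr : 0 < r)
    {θ : EuclideanSpace ℝ (Fin n)} (hθ : ‖θ‖ = 1) {t : ℝ} (ht : 0 < t) :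
    fracPoissonKernel α r (x + t • θ) x =
      poissonConst n α * rayProfile (α / 2) (r ^ 2 - ‖x‖ ^ 2) (inner ℝ x θ) t * (1 / t ^ n) := by
  have h1 : ‖x + t • θ‖ ^ 2 = ‖x‖ ^ 2 + (t ^ 2 + 2 * inner ℝ x θ * t) := by
    rw [norm_add_sq_real, inner_smul_right, norm_smul, hθ, Real.norm_eq_abs, mul_one, sq_abs]
    ring
  have h2 : r < ‖x + t • θ‖ ↔ r ^ 2 - ‖x‖ ^ 2 < t ^ 2 + 2 * inner ℝ x θ * t := by
    rw [← sq_lt_sq₀ hr.le (norm_nonneg _), h1]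
    constructor <;> intro h <;> linarith
  have h3 : ‖x - (x + t • θ)‖ = t := by
    rw [sub_add_cancel_left, norm_neg, norm_smul, hθ, Real.norm_eq_abs, abs_of_pos ht, mul_one]
  unfold fracPoissonKernel rayProfile poissonConst
  by_cases h : r < ‖x + t • θ‖
  · rw [if_pos h, if_pos (h2.1 h), h3, h1]
    congr 4
    ring
  · rw [if_neg h, if_neg (fun h' => h (h2.2 h'))]
    ring

/-- Polar coordinates about `x` for integrals against the Poisson kernel. -/
theorem lintegral_fracPoissonKernel_polar (hn : 1 ≤ n) (hr : 0 < r)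
    {g : EuclideanSpace ℝ (Fin n) → ℝ} (hg : Measurable g) :
    ∫⁻ z, ENNReal.ofReal (fracPoissonKernel α r (x + z) x * g z) =
      ∫⁻ θ, ∫⁻ t in Set.Ioi (0 : ℝ), ENNReal.ofReal (poissonConst n α *
        rayProfile (α / 2) (r ^ 2 - ‖x‖ ^ 2) (inner ℝ x (θ : EuclideanSpace ℝ (Fin n))) t * t⁻¹ *
          g (t • (θ : EuclideanSpace ℝ (Fin n)))) ∂volume
        ∂(volume : Measure (EuclideanSpace ℝ (Fin n))).toSphere := by
  have : Nonempty (Fin n) := ⟨⟨0, hn⟩⟩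
  have hm : Measurable fun z => fracPoissonKernel α r (x + z) x :=
    (measurable_fracPoissonKernel (α := α) (r := r) x).comp (measurable_const_add x)
  rw [lintegral_polar volume (by fun_prop)]
  refine lintegral_congr fun θ => setLIntegral_congr_fun measurableSet_Ioi fun t ht => ?_
  have ht' : 0 < t := ht
  rw [← ENNReal.ofReal_mul (by positivity),
    fracPoissonKernel_ray hr (by simp) ht', finrank_euclideanSpace_fin]
  congr 1
  obtain ⟨m, rfl⟩ : ∃ m, n = m + 1 := ⟨n - 1, by omega⟩
  rw [Nat.add_sub_cancel]
  field_simp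
  ring

/-- The same after the reflection `z ↦ -z`, which replaces `⟨x, θ⟩` by `-⟨x, θ⟩`. -/
theorem lintegral_fracPoissonKernel_polar_neg (hn : 1 ≤ n) (hr : 0 < r)
    {g : EuclideanSpace ℝ (Fin n) → ℝ} (hg : Measurable g) :
    ∫⁻ z, ENNReal.ofReal (fracPoissonKernel α r (x + z) x * g (-z)) =
      ∫⁻ θ, ∫⁻ t in Set.Ioi (0 : ℝ), ENNReal.ofReal (poissonConst n α *
        rayProfile (α / 2) (r ^ 2 - ‖x‖ ^ 2) (-inner ℝ x (θ : EuclideanSpace ℝ (Fin n))) t * t⁻¹ *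
          g (t • (θ : EuclideanSpace ℝ (Fin n)))) ∂volume
        ∂(volume : Measure (EuclideanSpace ℝ (Fin n))).toSphere := by
  have : Nonempty (Fin n) := ⟨⟨0, hn⟩⟩
  have hm : Measurable fun z => fracPoissonKernel α r (x + -z) x :=
    (measurable_fracPoissonKernel (α := α) (r := r) x).comp (by fun_prop)
  rw [← lintegral_neg_eq_self, lintegral_polar volume (by fun_prop)]
  refine lintegral_congr fun θ => setLIntegral_congr_fun measurableSet_Ioi fun t ht => ?_
  have ht' : 0 < t := ht
  rw [← ENNReal.ofReal_mul (by positivity), neg_neg, ← smul_neg,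
    fracPoissonKernel_ray hr (by simp) ht', finrank_euclideanSpace_fin, inner_neg_right]
  congr 1
  obtain ⟨m, rfl⟩ : ∃ m, n = m + 1 := ⟨n - 1, by omega⟩
  rw [Nat.add_sub_cancel]
  field_simp
  ring

/-- The surface area of the unit sphere. -/
theorem toSphere_univ_eq (hn : 1 ≤ n) :
    (volume : Measure (EuclideanSpace ℝ (Fin n))).toSphere Set.univ =
      ENNReal.ofReal (2 * Real.pi ^ ((n : ℝ) / 2) / Real.Gamma ((n : ℝ) / 2)) := by
  have : Nonempty (Fin n) := ⟨⟨0, hn⟩⟩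
  have hn' : (0 : ℝ) < n := by exact_mod_cast hn
  rw [Measure.toSphere_apply_univ, EuclideanSpace.volume_ball, finrank_euclideanSpace_fin,
    Fintype.card_fin, ENNReal.ofReal_one, one_pow, one_mul, ← ENNReal.ofReal_natCast,
    ← ENNReal.ofReal_mul hn'.le, Real.Gamma_add_one (by positivity), Real.sqrt_eq_rpow,
    ← Real.rpow_natCast, ← Real.rpow_mul Real.pi_pos.le]
  congr 1
  rw [show 1 / 2 * (n : ℝ) = n / 2 by ring]
  field_simp

/-- The Poisson kernel has total mass one: in polar coordinates about `x`, opposite directions add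
up to the same number. -/
theorem lintegral_fracPoissonKernel (hn : 1 ≤ n) (hα0 : 0 < α) (hα2 : α < 2) (hr : 0 < r)
    (hx : ‖x‖ < r) : ∫⁻ y, ENNReal.ofReal (fracPoissonKernel α r y x) = 1 := by
  have hA : 0 < r ^ 2 - ‖x‖ ^ 2 := by nlinarith [norm_nonneg x]
  have hκ := poissonConst_nonneg n hα0 hα2
  have e1 := lintegral_fracPoissonKernel_polar (α := α) (x := x) hn hr
    (measurable_const (a := (1 : ℝ)))
  have e2 := lintegral_fracPoissonKernel_polar_neg (α := α) (x := x) hn hr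
    (measurable_const (a := (1 : ℝ)))
  simp only [mul_one] at e1 e2
  have hpull : ∀ c, ∫⁻ t in Set.Ioi (0 : ℝ), ENNReal.ofReal (poissonConst n α *
        rayProfile (α / 2) (r ^ 2 - ‖x‖ ^ 2) c t * t⁻¹) = ENNReal.ofReal (poissonConst n α) *
      ∫⁻ t in Set.Ioi (0 : ℝ), ENNReal.ofReal
        (rayProfile (α / 2) (r ^ 2 - ‖x‖ ^ 2) c t * t⁻¹) := by
    intro c
    rw [← lintegral_const_mul' _ _ ENNReal.ofReal_ne_top]
    refine lintegral_congr fun t => ?_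
    rw [← ENNReal.ofReal_mul hκ, mul_assoc]
  simp_rw [hpull] at e1 e2
  have hmeas : Measurable fun θ : Metric.sphere (0 : EuclideanSpace ℝ (Fin n)) 1 =>
      ENNReal.ofReal (poissonConst n α) * ∫⁻ t in Set.Ioi (0 : ℝ), ENNReal.ofReal
        (rayProfile (α / 2) (r ^ 2 - ‖x‖ ^ 2)
          (inner ℝ x (θ : EuclideanSpace ℝ (Fin n))) t * t⁻¹) := by
    refine Measurable.const_mul (Measurable.lintegral_prod_right ?_) _
    unfold Function.uncurry rayProfile
    refine Measurable.ennreal_ofReal (Measurable.mul ?_ (by fun_prop))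
    exact Measurable.ite (measurableSet_lt (by fun_prop) (by fun_prop)) (by fun_prop)
      (by fun_prop)
  -- the mass is computed twice, over the rays in the directions `θ` and over those in `-θ`
  have hsum : (∫⁻ z, ENNReal.ofReal (fracPoissonKernel α r (x + z) x)) +
      ∫⁻ z, ENNReal.ofReal (fracPoissonKernel α r (x + z) x) = 2 := by
    nth_rewrite 1 [e1]
    rw [e2, ← lintegral_add_left hmeas]
    simp_rw [← mul_add, lintegral_rayProfile_add_neg (show 0 < α / 2 by linarith)
      (show α / 2 < 1 by linarith) hA]
    rw [lintegral_const, toSphere_univ_eq hn, ← ENNReal.ofReal_mul hκ,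
      ← ENNReal.ofReal_mul (mul_nonneg hκ (by
        have := sin_pi_mul_half_pos hα0 hα2
        rw [← mul_div_assoc]; positivity)), ← ENNReal.ofReal_ofNat 2]
    congr 1
    have hs := (sin_pi_mul_half_pos hα0 hα2).ne'
    have hn' : (0 : ℝ) < n := by exact_mod_cast hn
    have hG := (Real.Gamma_pos_of_pos (show (0 : ℝ) < n / 2 by positivity)).ne'
    have hpi : Real.pi ^ ((n : ℝ) / 2) ≠ 0 := (Real.rpow_pos_of_pos Real.pi_pos _).ne'
    rw [poissonConst, Real.rpow_add_one Real.pi_pos.ne', ← mul_div_assoc Real.pi α 2]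
    field_simp
  rw [lintegral_add_left_eq_self (fun y => ENNReal.ofReal (fracPoissonKernel α r y x)) x] at hsum
  rw [← two_mul] at hsum
  have := (ENNReal.mul_right_inj (a := 2) (b := ∫⁻ y, ENNReal.ofReal (fracPoissonKernel α r y x))
    (c := 1) (by norm_num) (by norm_num)).1 (by rw [hsum, mul_one])
  exact this

theorem integrable_fracPoissonKernel (hn : 1 ≤ n) (hα0 : 0 < α) (hα2 : α < 2) (hr : 0 < r)
    (hx : ‖x‖ < r) : Integrable fun y => fracPoissonKernel α r y x := by
  refine ⟨(measurable_fracPoissonKernel x).aestronglyMeasurable, ?_⟩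
  rw [hasFiniteIntegral_iff_ofReal
    (Eventually.of_forall (fracPoissonKernel_nonneg hα0 hα2 hr hx)),
    lintegral_fracPoissonKernel hn hα0 hα2 hr hx]
  exact ENNReal.one_lt_top

theorem integral_fracPoissonKernel (hn : 1 ≤ n) (hα0 : 0 < α) (hα2 : α < 2) (hr : 0 < r)
    (hx : ‖x‖ < r) : ∫ y, fracPoissonKernel α r y x = 1 := by
  rw [integral_eq_lintegral_of_nonneg_ae
    (Eventually.of_forall (fracPoissonKernel_nonneg hα0 hα2 hr hx))
    (measurable_fracPoissonKernel x).aestronglyMeasurable,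
    lintegral_fracPoissonKernel hn hα0 hα2 hr hx, ENNReal.toReal_one]

/-- The first moment of the Poisson kernel about `x` vanishes. -/
theorem integral_fracPoissonKernel_inner (hn : 1 ≤ n) (hα0 : 0 < α) (hα2 : α < 2) (hr : 0 < r)
    (hx : ‖x‖ < r) (b : EuclideanSpace ℝ (Fin n))
    (hint : Integrable fun y => fracPoissonKernel α r y x * inner ℝ b (y - x)) :
    ∫ y, fracPoissonKernel α r y x * inner ℝ b (y - x) = 0 := by
  have hA : 0 < r ^ 2 - ‖x‖ ^ 2 := by nlinarith [norm_nonneg x]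
  have hκ := poissonConst_nonneg n hα0 hα2
  rw [← integral_add_left_eq_self _ x]
  simp only [add_sub_cancel_left]
  have hint' : Integrable fun z => fracPoissonKernel α r (x + z) x * inner ℝ b z := by
    simpa only [add_sub_cancel_left] using hint.comp_add_left x
  -- the positive and the negative part have the same integral, being exchanged by `θ ↦ -θ`
  rw [integral_eq_lintegral_pos_part_sub_lintegral_neg_part hint']
  have hb : Measurable fun z : EuclideanSpace ℝ (Fin n) => (inner ℝ b z : ℝ) := by fun_prop
  have e1 := lintegral_fracPoissonKernel_polar (α := α) (x := x) hn hr hb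
  have e2 := lintegral_fracPoissonKernel_polar_neg (α := α) (x := x) hn hr hb
  simp only [inner_neg_right, mul_neg] at e2
  rw [e1, e2, sub_eq_zero]
  congr 1
  refine lintegral_congr fun θ => ?_
  have hpull : ∀ c, ∫⁻ t in Set.Ioi (0 : ℝ), ENNReal.ofReal (poissonConst n α *
        rayProfile (α / 2) (r ^ 2 - ‖x‖ ^ 2) c t * t⁻¹ *
          inner ℝ b (t • (θ : EuclideanSpace ℝ (Fin n)))) =
      ENNReal.ofReal (poissonConst n α * inner ℝ b (θ : EuclideanSpace ℝ (Fin n))) *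
      ∫⁻ t in Set.Ioi (0 : ℝ), ENNReal.ofReal
        (rayProfile (α / 2) (r ^ 2 - ‖x‖ ^ 2) c t) := by
    intro c
    rw [← lintegral_const_mul' _ _ ENNReal.ofReal_ne_top]
    refine setLIntegral_congr_fun measurableSet_Ioi fun t ht => ?_
    have ht' : 0 < t := ht
    have hq : 0 ≤ rayProfile (α / 2) (r ^ 2 - ‖x‖ ^ 2) c t := by
      unfold rayProfile
      split_ifs with h
      · exact Real.rpow_nonneg (div_nonneg hA.le (by linarith)) _
      · exact le_rfl
    rw [← ENNReal.ofReal_mul' hq, inner_smul_right]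
    congr 1
    field_simp
  rw [hpull, hpull, lintegral_rayProfile_neg hA]

end Poisson

/-! ### Weights -/

section Weights

variable {n : ℕ}

theorem one_add_rpow_le {s t : ℝ} (hs : 0 ≤ s) (ht : 0 ≤ t) :
    (1 + t) ^ s ≤ 2 ^ s * (1 + t ^ s) := by
  have hts : 0 ≤ t ^ s := Real.rpow_nonneg ht s
  have h2 : (0 : ℝ) ≤ 2 ^ s := by positivity
  rcases le_total t 1 with h | h
  · calc (1 + t) ^ s ≤ 2 ^ s := Real.rpow_le_rpow (by linarith) (by linarith) hs
      _ ≤ 2 ^ s * (1 + t ^ s) := by nlinarith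
  · calc (1 + t) ^ s ≤ (2 * t) ^ s := Real.rpow_le_rpow (by linarith) (by linarith) hs
      _ = 2 ^ s * t ^ s := Real.mul_rpow (by norm_num) ht
      _ ≤ 2 ^ s * (1 + t ^ s) := by nlinarith

theorem one_add_rpow_ge {s t : ℝ} (hs : 0 ≤ s) (ht : 0 ≤ t) : 1 + t ^ s ≤ 2 * (1 + t) ^ s := by
  have h1 : 1 ≤ (1 + t) ^ s := Real.one_le_rpow (by linarith) hs
  have h2 : t ^ s ≤ (1 + t) ^ s := Real.rpow_le_rpow ht (by linarith) hs
  linarith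

theorem integrable_inv_one_add_norm_rpow {s : ℝ} (hs : n < s) :
    Integrable (fun x : EuclideanSpace ℝ (Fin n) => 1 / (1 + ‖x‖ ^ s)) := by
  have hs0 : 0 ≤ s := (Nat.cast_nonneg n).trans hs.le
  have h := (integrable_one_add_norm (E := EuclideanSpace ℝ (Fin n)) (μ := volume) (r := s)
    (by simpa using hs)).const_mul (2 ^ s)
  refine h.mono' (Measurable.aestronglyMeasurable (by fun_prop)) (Eventually.of_forall fun x => ?_)
  have hx : 0 ≤ ‖x‖ ^ s := Real.rpow_nonneg (norm_nonneg x) s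
  have h1 : 0 < (1 + ‖x‖) ^ s := by positivity
  rw [Real.norm_of_nonneg (by positivity), Real.rpow_neg (by positivity), ← div_eq_mul_inv,
    div_le_div_iff₀ (by positivity) h1, one_mul]
  exact one_add_rpow_le hs0 (norm_nonneg x)

/-- Away from `x`, the kernel `|x - z|^(-s)` is dominated by the weight `1 / (1 + |z|^s)`. -/
theorem exists_inv_norm_sub_rpow_le {s ε : ℝ} (hs : 0 ≤ s) (hε : 0 < ε)
    (x : EuclideanSpace ℝ (Fin n)) : ∃ C, 0 ≤ C ∧ ∀ z, ε ≤ ‖x - z‖ →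
      1 / ‖x - z‖ ^ s ≤ C * (1 / (1 + ‖z‖ ^ s)) := by
  refine ⟨(1 / ε) ^ s + (1 + ‖x‖ / ε) ^ s, by positivity, fun z hz => ?_⟩
  have hd : 0 < ‖x - z‖ := hε.trans_le hz
  have hd' : 0 < ‖x - z‖ ^ s := by positivity
  have hz' : 0 ≤ ‖z‖ ^ s := Real.rpow_nonneg (norm_nonneg z) s
  have h1 : 1 ≤ (1 / ε) ^ s * ‖x - z‖ ^ s := by
    rw [← Real.mul_rpow (by positivity) hd.le]
    refine Real.one_le_rpow ?_ hs
    rw [one_div, inv_mul_eq_div, le_div_iff₀ hε]; linarith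
  have h2 : ‖z‖ ^ s ≤ (1 + ‖x‖ / ε) ^ s * ‖x - z‖ ^ s := by
    rw [← Real.mul_rpow (by positivity) hd.le]
    refine Real.rpow_le_rpow (norm_nonneg z) ?_ hs
    have h3 : ‖z‖ ≤ ‖x‖ + ‖x - z‖ := by
      simpa using norm_sub_le x (x - z)
    have h4 : ‖x‖ ≤ ‖x‖ / ε * ‖x - z‖ := by
      rw [div_mul_eq_mul_div, le_div_iff₀ hε]
      exact mul_le_mul_of_nonneg_left hz (norm_nonneg x)
    linarith
  rw [← mul_div_assoc, mul_one, div_le_div_iff₀ hd' (by positivity)]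
  linarith

end Weights

/-! ### Functions that agree almost everywhere with an affine function -/

section Affine

variable {n : ℕ} {α r : ℝ} {x : EuclideanSpace ℝ (Fin n)} {u : EuclideanSpace ℝ (Fin n) → ℝ}
  {a : ℝ} {b : EuclideanSpace ℝ (Fin n)}

/-- Far from the ball the Poisson kernel is bounded by the weight defining `L_α`. -/
theorem fracPoissonKernel_le_of_two_mul_le (hα0 : 0 < α) (hα2 : α < 2) (hr : 0 < r)
    (hx : ‖x‖ < r) : ∃ C, 0 ≤ C ∧ ∀ y, 2 * r ≤ ‖y‖ →
      fracPoissonKernel α r y x ≤ C * (1 / (1 + ‖y‖ ^ ((n : ℝ) + α))) := by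
  obtain ⟨C, hC0, hC⟩ := exists_inv_norm_sub_rpow_le (n := n) (s := (n : ℝ) + α) (ε := 2 * r)
    (by positivity) (by positivity) 0
  have hκ := poissonConst_nonneg n hα0 hα2
  refine ⟨poissonConst n α * ((2 * r) ^ α * 2 ^ n) * C, by positivity, fun y hy => ?_⟩
  have hy0 : 0 < ‖y‖ := by linarith
  have hC' := hC y (by simpa using hy)
  rw [zero_sub, norm_neg] at hC'
  have hq : ((r ^ 2 - ‖x‖ ^ 2) / (‖y‖ ^ 2 - r ^ 2)) ^ (α / 2) ≤ (2 * r) ^ α / ‖y‖ ^ α := by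
    have hden : 0 < ‖y‖ ^ 2 - r ^ 2 := by nlinarith
    have : (r ^ 2 - ‖x‖ ^ 2) / (‖y‖ ^ 2 - r ^ 2) ≤ (2 * r / ‖y‖) ^ 2 := by
      rw [div_pow, div_le_div_iff₀ hden (by positivity)]
      nlinarith [sq_nonneg ‖x‖, mul_nonneg (sq_nonneg ‖x‖) (sq_nonneg ‖y‖), mul_pos hr hr,
        mul_nonneg (sq_nonneg r) (show 0 ≤ ‖y‖ ^ 2 - 4 * r ^ 2 by nlinarith)]
    refine (Real.rpow_le_rpow (div_nonneg (by nlinarith [norm_nonneg x]) hden.le) this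
      (by positivity)).trans_eq ?_
    rw [← Real.rpow_natCast, ← Real.rpow_mul (by positivity), ← Real.div_rpow (by positivity)
      hy0.le]
    congr 1
    push_cast
    ring
  have hd : 1 / ‖x - y‖ ^ n ≤ 2 ^ n / ‖y‖ ^ n := by
    have h1 : ‖y‖ / 2 ≤ ‖x - y‖ := by
      have := norm_sub_norm_le y x
      rw [norm_sub_rev] at this
      linarith
    rw [← div_pow, ← one_div_pow]
    refine pow_le_pow_left₀ (by positivity) ?_ n
    rw [div_le_div_iff₀ (by linarith) hy0]
    linarith
  have hle : fracPoissonKernel α r y x ≤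
      poissonConst n α * ((2 * r) ^ α / ‖y‖ ^ α * (2 ^ n / ‖y‖ ^ n)) := by
    unfold fracPoissonKernel
    rw [if_pos (by linarith), mul_assoc]
    refine mul_le_mul_of_nonneg_left (mul_le_mul hq hd (by positivity) (by positivity)) hκ
  refine hle.trans ?_
  rw [mul_assoc _ C, show poissonConst n α * ((2 * r) ^ α / ‖y‖ ^ α * (2 ^ n / ‖y‖ ^ n)) =
    poissonConst n α * ((2 * r) ^ α * 2 ^ n) * (1 / ‖y‖ ^ ((n : ℝ) + α)) by
      rw [Real.rpow_add hy0, Real.rpow_natCast]; field_simp]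
  exact mul_le_mul_of_nonneg_left hC' (by positivity)

theorem integrable_affine_div_weight (hu : MemLAlpha α u) (h : ∀ᵐ y, u y = a + inner ℝ b y) :
    Integrable fun y => |a + inner ℝ b y| * (1 / (1 + ‖y‖ ^ ((n : ℝ) + α))) := by
  refine hu.2.congr ?_
  filter_upwards [h] with y hy
  rw [hy, mul_one_div]

/-- Near the ball the affine function is bounded and the kernel is integrable; far away the
kernel is bounded by the weight of `L_α`. -/
theorem integrable_fracPoissonKernel_mul_affine (hn : 1 ≤ n) (hα0 : 0 < α) (hα2 : α < 2)
    (hr : 0 < r) (hx : ‖x‖ < r) (hu : MemLAlpha α u) (h : ∀ᵐ y, u y = a + inner ℝ b y) :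
    Integrable fun y => fracPoissonKernel α r y x * (a + inner ℝ b y) := by
  obtain ⟨C, hC0, hC⟩ := fracPoissonKernel_le_of_two_mul_le hα0 hα2 hr hx
  have hdom := ((integrable_fracPoissonKernel hn hα0 hα2 hr hx).mul_const
    (|a| + ‖b‖ * (2 * r))).add ((integrable_affine_div_weight hu h).const_mul C)
  refine hdom.mono' ((measurable_fracPoissonKernel x).mul (by fun_prop)).aestronglyMeasurable
    (Eventually.of_forall fun y => ?_)
  have hP := fracPoissonKernel_nonneg hα0 hα2 hr hx y
  rw [norm_mul, Real.norm_of_nonneg hP, Real.norm_eq_abs, Pi.add_apply]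
  have hw : 0 ≤ ‖y‖ ^ ((n : ℝ) + α) := Real.rpow_nonneg (norm_nonneg y) _
  rcases le_total (2 * r) ‖y‖ with hy | hy
  · have := mul_le_mul_of_nonneg_right (hC y hy) (abs_nonneg (a + inner ℝ b y))
    have h2 : 0 ≤ fracPoissonKernel α r y x * (|a| + ‖b‖ * (2 * r)) := by positivity
    linarith
  · have h1 : |a + inner ℝ b y| ≤ |a| + ‖b‖ * (2 * r) :=
      (abs_add_le _ _).trans (add_le_add_right ((abs_real_inner_le_norm b y).trans
        (mul_le_mul_of_nonneg_left hy (norm_nonneg b))) _)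
    have h2 := mul_le_mul_of_nonneg_left h1 hP
    have h3 : 0 ≤ C * (|a + inner ℝ b y| * (1 / (1 + ‖y‖ ^ ((n : ℝ) + α)))) := by positivity
    linarith

theorem integrable_fracPoissonKernel_mul (hn : 1 ≤ n) (hα0 : 0 < α) (hα2 : α < 2)
    (hr : 0 < r) (hx : ‖x‖ < r) (hu : MemLAlpha α u) (h : ∀ᵐ y, u y = a + inner ℝ b y) :
    Integrable fun y => fracPoissonKernel α r y x * u y := by
  refine (integrable_fracPoissonKernel_mul_affine hn hα0 hα2 hr hx hu h).congr ?_
  filter_upwards [h] with y hy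
  rw [hy]

theorem setIntegral_fracPoissonKernel_mul (hn : 1 ≤ n) (hα0 : 0 < α) (hα2 : α < 2)
    (hr : 0 < r) (hx : ‖x‖ < r) (hu : MemLAlpha α u) (h : ∀ᵐ y, u y = a + inner ℝ b y) :
    ∫ y in {y | r < ‖y‖}, fracPoissonKernel α r y x * u y = a + inner ℝ b x := by
  rw [setIntegral_eq_integral_of_forall_compl_eq_zero fun y hy => by
    rw [fracPoissonKernel, if_neg (show ¬r < ‖y‖ from hy), zero_mul]]
  have hP := integrable_fracPoissonKernel hn hα0 hα2 hr hx
  have hPl := integrable_fracPoissonKernel_mul_affine hn hα0 hα2 hr hx hu h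
  have hPx := hP.mul_const (a + inner ℝ b x)
  have heq : (fun y => fracPoissonKernel α r y x * inner ℝ b (y - x)) =
      fun y => fracPoissonKernel α r y x * (a + inner ℝ b y) -
        fracPoissonKernel α r y x * (a + inner ℝ b x) := by
    ext y; rw [inner_sub_right]; ring
  have h0 := integral_fracPoissonKernel_inner hn hα0 hα2 hr hx b (by
    rw [heq]; exact hPl.sub hPx)
  rw [heq, integral_sub hPl hPx, integral_mul_const, integral_fracPoissonKernel hn hα0 hα2 hr hx,
    one_mul, sub_eq_zero] at h0
  rw [← h0]
  refine integral_congr_ae ?_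
  filter_upwards [h] with y hy
  rw [hy]

theorem eq_affine_of_continuousAt (h : ∀ᵐ y, u y = a + inner ℝ b y) (hc : ContinuousAt u x) :
    u x = a + inner ℝ b x := by
  have hfreq : ∃ᶠ y in 𝓝 x, u y = a + inner ℝ b y :=
    mem_closure_iff_frequently.1 (Measure.dense_of_ae h x)
  have hcont : Continuous fun y : EuclideanSpace ℝ (Fin n) => a + inner ℝ b y := by fun_prop
  exact tendsto_nhds_unique_of_frequently_eq hc (hcont.tendsto x) hfreq

/-- The truncated integrals of an affine function vanish by reflection about `x`. -/
theorem hasFracLaplacianAt_of_ae_affine (hα0 : 0 < α) {v : EuclideanSpace ℝ (Fin n) → ℝ}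
    (hv : MemLAlpha α v) (h : ∀ᵐ y, v y = a + inner ℝ b y) (hx : v x = a + inner ℝ b x) :
    HasFracLaplacianAt α v x 0 := by
  have hcongr : ∀ᵐ z, (v x - v z) / ‖x - z‖ ^ ((n : ℝ) + α) =
      inner ℝ b (x - z) / ‖x - z‖ ^ ((n : ℝ) + α) := by
    filter_upwards [h] with z hz
    rw [hx, hz, inner_sub_right]
    ring
  refine ⟨fun ε hε => ?_, ?_⟩
  · obtain ⟨C, hC0, hC⟩ := exists_inv_norm_sub_rpow_le (n := n) (s := (n : ℝ) + α)
      (by positivity) hε x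
    have hdom := (((integrable_affine_div_weight hv h).add
      ((integrable_inv_one_add_norm_rpow (n := n) (s := (n : ℝ) + α) (by linarith)).const_mul
        |a + inner ℝ b x|)).const_mul C).integrableOn (s := (Metric.ball x ε)ᶜ)
    refine Integrable.congr (f := fun z => inner ℝ b (x - z) / ‖x - z‖ ^ ((n : ℝ) + α)) ?_
      (ae_restrict_of_ae (hcongr.mono fun z hz => hz.symm))
    refine hdom.mono' (Measurable.aestronglyMeasurable (by fun_prop)) ?_
    filter_upwards [ae_restrict_mem Metric.isOpen_ball.measurableSet.compl] with z hz
    have hz' : ε ≤ ‖x - z‖ := by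
      rw [Set.mem_compl_iff, Metric.mem_ball, not_lt, dist_comm, dist_eq_norm] at hz
      exact hz
    have h1 : |inner ℝ b (x - z)| ≤ |a + inner ℝ b z| + |a + inner ℝ b x| := by
      rw [show inner ℝ b (x - z) = (a + inner ℝ b x) - (a + inner ℝ b z) by
        rw [inner_sub_right]; ring]
      exact (abs_sub _ _).trans (add_comm _ _).le
    have hw : 0 ≤ ‖z‖ ^ ((n : ℝ) + α) := Real.rpow_nonneg (norm_nonneg z) _
    have hw' : 0 ≤ ‖x - z‖ ^ ((n : ℝ) + α) := Real.rpow_nonneg (norm_nonneg _) _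
    rw [norm_div, Real.norm_eq_abs, Real.norm_of_nonneg hw', div_eq_mul_one_div, Pi.add_apply]
    refine (mul_le_mul h1 (hC z hz') (by positivity) (by positivity)).trans_eq ?_
    ring
  · refine tendsto_const_nhds.congr fun ε => ?_
    rw [truncFracLaplacian, setIntegral_congr_ae
      (Metric.isOpen_ball.measurableSet.compl) (hcongr.mono fun z hz _ => hz)]
    set f : EuclideanSpace ℝ (Fin n) → ℝ := (Metric.ball x ε)ᶜ.indicator
      fun z => inner ℝ b (x - z) / ‖x - z‖ ^ ((n : ℝ) + α) with hf
    have hodd : ∀ z, f ((x + x) - z) = -f z := by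
      intro z
      have e : x - (x + x - z) = -(x - z) := by abel
      have hm : x + x - z ∈ (Metric.ball x ε)ᶜ ↔ z ∈ (Metric.ball x ε)ᶜ := by
        simp only [Set.mem_compl_iff, Metric.mem_ball]
        rw [dist_comm, dist_eq_norm, e, norm_neg, dist_comm z, dist_eq_norm]
      by_cases hz : z ∈ (Metric.ball x ε)ᶜ
      · rw [hf, Set.indicator_of_mem hz, Set.indicator_of_mem (hm.2 hz), e, norm_neg,
          inner_neg_right, neg_div]
      · rw [hf, Set.indicator_of_notMem hz, Set.indicator_of_notMem fun h' => hz (hm.1 h'),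
          neg_zero]
    have hI : ∫ z, f z = 0 := by
      have h1 := integral_sub_left_eq_self f volume (x + x)
      simp_rw [hodd, integral_neg] at h1
      linarith
    rw [← integral_indicator Metric.isOpen_ball.measurableSet.compl, ← hf, hI, mul_zero]

end Affine

/-! ### Second differences and decay -/

section SecondDiff

variable {n : ℕ} {V : Type*} [NormedAddCommGroup V] [NormedSpace ℝ V]

/-- The symmetric second difference `2 f(x) - f(x + z) - f(x - z)`. -/
def secondDiff {E V : Type*} [AddGroup E] [AddCommGroup V] [Module ℝ V] (f : E → V) (x z : E) : V :=
  (2 : ℝ) • f x - f (x + z) - f (x - z)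

/-- The second difference is bounded by the second derivative: the mean value inequality is applied
to `y ↦ f(y + z) - f(y)` between `x - z` and `x`, and to `fderiv ℝ f`. -/
theorem norm_secondDiff_le {E : Type*} [NormedAddCommGroup E] [NormedSpace ℝ E] {f : E → V}
    (hf : ContDiff ℝ 2 f) {x z : E} {A : ℝ}
    (hA : ∀ y ∈ Metric.closedBall x ‖z‖, ‖iteratedFDeriv ℝ 2 f y‖ ≤ A) :
    ‖secondDiff f x z‖ ≤ A * ‖z‖ ^ 2 := by
  have hf1 : Differentiable ℝ f := hf.differentiable (by norm_num)
  have hf2 : Differentiable ℝ (fderiv ℝ f) :=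
    (hf.fderiv_right (m := 1) (by norm_num)).differentiable (by norm_num)
  have hlip : ∀ y ∈ Metric.closedBall x ‖z‖, ∀ y' ∈ Metric.closedBall x ‖z‖,
      ‖fderiv ℝ f y' - fderiv ℝ f y‖ ≤ A * ‖y' - y‖ := fun y hy y' hy' =>
    (convex_closedBall x ‖z‖).norm_image_sub_le_of_norm_fderiv_le (fun w _ => hf2 w)
      (fun w hw => by
        rw [← norm_iteratedFDeriv_one, norm_iteratedFDeriv_fderiv]; exact hA w hw) hy hy'
  have hfd : ∀ y, fderiv ℝ (fun y => f (y + z) - f y) y = fderiv ℝ f (y + z) - fderiv ℝ f y := by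
    intro y
    rw [fderiv_fun_sub (by fun_prop) (hf1 y), fderiv_comp_add_right]
  have key := ((convex_closedBall x ‖z‖).inter
    (convex_closedBall (x - z) ‖z‖)).norm_image_sub_le_of_norm_fderiv_le
    (f := fun y => f (y + z) - f y) (C := A * ‖z‖) (x := x - z) (y := x)
    (fun w _ => by fun_prop) (fun w hw => by
      rw [hfd]
      have h := hlip w hw.1 (w + z) (by
        have := hw.2
        rw [Metric.mem_closedBall, dist_eq_norm] at this ⊢
        rwa [show w + z - x = w - (x - z) by abel])
      rwa [add_sub_cancel_left] at h) (by simp) (by simp)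
  have : secondDiff f x z = -((f (x + z) - f x) - (f (x - z + z) - f (x - z))) := by
    rw [secondDiff, sub_add_cancel, two_smul]; abel
  rw [this, norm_neg]
  refine key.trans_eq ?_
  rw [sub_sub_cancel]; ring

/-- Peetre's inequality. -/
theorem one_add_norm_rpow_neg_le {E : Type*} [NormedAddCommGroup E] {s : ℝ} (hs : 0 ≤ s)
    (x y : E) : (1 + ‖y‖) ^ (-s) ≤ (1 + ‖x - y‖) ^ s * (1 + ‖x‖) ^ (-s) := by
  have h : 1 + ‖x‖ ≤ (1 + ‖x - y‖) * (1 + ‖y‖) := by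
    have : ‖x‖ ≤ ‖x - y‖ + ‖y‖ := by simpa using norm_add_le (x - y) y
    nlinarith [mul_nonneg (norm_nonneg (x - y)) (norm_nonneg y)]
  have h2 : (1 + ‖x‖) ^ s ≤ (1 + ‖x - y‖) ^ s * (1 + ‖y‖) ^ s := by
    rw [← Real.mul_rpow (by positivity) (by positivity)]
    exact Real.rpow_le_rpow (by positivity) h hs
  rw [Real.rpow_neg (by positivity), Real.rpow_neg (by positivity), ← div_eq_mul_inv,
    inv_eq_one_div, div_le_div_iff₀ (by positivity) (by positivity), one_mul]
  exact h2

theorem SchwartzMap.exists_norm_iteratedFDeriv_le {E : Type*} [NormedAddCommGroup E]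
    [NormedSpace ℝ E] (f : SchwartzMap E V) (j : ℕ) (σ : ℝ) :
    ∃ M, 0 ≤ M ∧ ∀ y, ‖iteratedFDeriv ℝ j f y‖ ≤ M * (1 + ‖y‖) ^ (-σ) := by
  obtain ⟨k, hk⟩ := exists_nat_ge σ
  refine ⟨2 ^ k * (Finset.Iic (k, j)).sup (fun m => SchwartzMap.seminorm ℝ m.1 m.2) f,
    by positivity, fun y => ?_⟩
  have h := SchwartzMap.one_add_le_sup_seminorm_apply (𝕜 := ℝ) (m := (k, j)) le_rfl le_rfl f y
  have h1 : (1 + ‖y‖) ^ σ ≤ (1 + ‖y‖) ^ k := by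
    rw [← Real.rpow_natCast]
    exact Real.rpow_le_rpow_of_exponent_le (by linarith [norm_nonneg y]) hk
  rw [Real.rpow_neg (by positivity), ← div_eq_mul_inv, le_div_iff₀ (by positivity)]
  refine le_trans ?_ h
  rw [mul_comm]
  exact mul_le_mul_of_nonneg_right h1 (norm_nonneg _)

/-- Decay of a `C²` function: order `s + n + 1` for the function itself, order `s` for its second
derivative. The constant `M` is explicit, so that families can be bounded uniformly. -/
structure HasDecay (s M : ℝ) (f : EuclideanSpace ℝ (Fin n) → V) : Prop where
  contDiff : ContDiff ℝ 2 f
  norm_le : ∀ y, ‖f y‖ ≤ M * (1 + ‖y‖) ^ (-(s + n + 1))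
  norm_iteratedFDeriv_le : ∀ y, ‖iteratedFDeriv ℝ 2 f y‖ ≤ M * (1 + ‖y‖) ^ (-s)

theorem SchwartzMap.exists_hasDecay (f : SchwartzMap (EuclideanSpace ℝ (Fin n)) V) (s : ℝ) :
    ∃ M, 0 ≤ M ∧ HasDecay s M f := by
  obtain ⟨M₀, h₀, H₀⟩ := f.exists_norm_iteratedFDeriv_le 0 (s + n + 1)
  obtain ⟨M₂, h₂, H₂⟩ := f.exists_norm_iteratedFDeriv_le 2 s
  refine ⟨max M₀ M₂, le_max_of_le_left h₀, f.smooth 2, fun y => ?_, fun y => ?_⟩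
  · have := H₀ y
    rw [norm_iteratedFDeriv_zero] at this
    exact this.trans (mul_le_mul_of_nonneg_right (le_max_left _ _) (by positivity))
  · exact (H₂ y).trans (mul_le_mul_of_nonneg_right (le_max_right _ _) (by positivity))

/-- The function of `z`, with integral independent of `x`, which up to a factor
`O((1 + |x|)^(-s))` dominates the integrand of the fractional Laplacian. -/
noncomputable def secondDiffMajorant (s : ℝ) (x z : EuclideanSpace ℝ (Fin n)) : ℝ :=
  (Metric.ball 0 1).indicator (fun z => ‖z‖ ^ (2 - s)) z + 2 * (1 + ‖z‖) ^ (-s) +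
    (1 + ‖x + z‖) ^ (-((n : ℝ) + 1)) + (1 + ‖x - z‖) ^ (-((n : ℝ) + 1))

theorem integrable_indicator_norm_rpow (hn : 1 ≤ n) {s : ℝ} (hs : s < n + 2) :
    Integrable ((Metric.ball (0 : EuclideanSpace ℝ (Fin n)) 1).indicator
      fun z => ‖z‖ ^ (2 - s)) := by
  have : Nonempty (Fin n) := ⟨⟨0, hn⟩⟩
  rw [integrable_indicator_iff Metric.isOpen_ball.measurableSet,
    integrableOn_fun_norm_addHaar (μ := volume) (f := fun t : ℝ => t ^ (2 - s)),
    finrank_euclideanSpace_fin]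
  have h : IntegrableOn (fun t : ℝ => t ^ ((n : ℝ) + 1 - s)) (Set.Ioo 0 1) :=
    (intervalIntegral.integrableOn_Ioo_rpow_iff zero_lt_one).2 (by linarith)
  refine h.congr_fun (fun t ht => ?_) measurableSet_Ioo
  simp only [smul_eq_mul]
  rw [← Real.rpow_natCast, ← Real.rpow_add ht.1, Nat.cast_sub hn]
  congr 1
  push_cast
  ring

theorem integrable_one_add_norm_rpow {s : ℝ} (hs : n < s) :
    Integrable (fun x : EuclideanSpace ℝ (Fin n) => (1 + ‖x‖) ^ (-s)) :=
  integrable_one_add_norm (by simpa using hs)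

theorem integrable_secondDiffMajorant (hn : 1 ≤ n) {s : ℝ} (hs : n < s) (hs2 : s < n + 2)
    (x : EuclideanSpace ℝ (Fin n)) : Integrable (secondDiffMajorant s x) := by
  have h := integrable_one_add_norm_rpow (n := n) (s := (n : ℝ) + 1) (by linarith)
  exact (((integrable_indicator_norm_rpow hn hs2).add
    ((integrable_one_add_norm_rpow hs).const_mul 2)).add (h.comp_add_left x)).add
      (h.comp_sub_left x)

theorem integral_secondDiffMajorant (hn : 1 ≤ n) {s : ℝ} (hs : n < s) (hs2 : s < n + 2)
    (x : EuclideanSpace ℝ (Fin n)) :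
    ∫ z, secondDiffMajorant s x z = ∫ z, secondDiffMajorant s (0 : EuclideanSpace ℝ (Fin n)) z := by
  have h := integrable_one_add_norm_rpow (n := n) (s := (n : ℝ) + 1) (by linarith)
  have key : ∀ x : EuclideanSpace ℝ (Fin n), ∫ z, secondDiffMajorant s x z =
      (∫ z, ((Metric.ball (0 : EuclideanSpace ℝ (Fin n)) 1).indicator (fun z => ‖z‖ ^ (2 - s)) z +
        2 * (1 + ‖z‖) ^ (-s))) + (∫ z : EuclideanSpace ℝ (Fin n), (1 + ‖z‖) ^ (-((n : ℝ) + 1))) +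
        ∫ z : EuclideanSpace ℝ (Fin n), (1 + ‖z‖) ^ (-((n : ℝ) + 1)) := by
    intro x
    have h0 : Integrable fun z : EuclideanSpace ℝ (Fin n) =>
        (Metric.ball 0 1).indicator (fun z => ‖z‖ ^ (2 - s)) z + 2 * (1 + ‖z‖) ^ (-s) :=
      (integrable_indicator_norm_rpow hn hs2).add ((integrable_one_add_norm_rpow hs).const_mul 2)
    have h1 : Integrable fun z : EuclideanSpace ℝ (Fin n) =>
        (Metric.ball 0 1).indicator (fun z => ‖z‖ ^ (2 - s)) z + 2 * (1 + ‖z‖) ^ (-s) +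
          (1 + ‖x + z‖) ^ (-((n : ℝ) + 1)) := h0.add (h.comp_add_left x)
    unfold secondDiffMajorant
    rw [integral_add h1 (h.comp_sub_left x), integral_add h0 (h.comp_add_left x),
      integral_add_left_eq_self (fun z => (1 + ‖z‖) ^ (-((n : ℝ) + 1))) x,
      integral_sub_left_eq_self (fun z => (1 + ‖z‖) ^ (-((n : ℝ) + 1))) volume x]
  rw [key, key]

/-- For `|z| < 1` the second difference is controlled by the second derivative near `x`; for
`|z| ≥ 1` its three terms are estimated separately, by Peetre's inequality for `f(x ± z)`. -/
theorem HasDecay.norm_integrand_le {s M : ℝ} (hs : 0 < s) (hM : 0 ≤ M)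
    {f : EuclideanSpace ℝ (Fin n) → V} (hf : HasDecay s M f) (x z : EuclideanSpace ℝ (Fin n)) :
    ‖(‖z‖ ^ s)⁻¹ • secondDiff f x z‖ ≤
      2 ^ s * M * (1 + ‖x‖) ^ (-s) * secondDiffMajorant s x z := by
  have hw : 0 ≤ (1 + ‖x‖) ^ (-s) := by positivity
  have hz0 : 0 ≤ ‖z‖ ^ s := Real.rpow_nonneg (norm_nonneg z) s
  rw [norm_smul, norm_inv, Real.norm_of_nonneg hz0]
  by_cases hz : z ∈ Metric.ball (0 : EuclideanSpace ℝ (Fin n)) 1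
  · have hz1 : ‖z‖ < 1 := by simpa using hz
    have hsd : ‖secondDiff f x z‖ ≤ (2 ^ s * M * (1 + ‖x‖) ^ (-s)) * ‖z‖ ^ 2 := by
      refine norm_secondDiff_le hf.contDiff fun y hy => ?_
      refine (hf.norm_iteratedFDeriv_le y).trans ?_
      have hxy : ‖x - y‖ ≤ 1 := by
        rw [Metric.mem_closedBall, dist_comm, dist_eq_norm] at hy; linarith
      have h1 : (1 + ‖x - y‖) ^ s ≤ 2 ^ s :=
        Real.rpow_le_rpow (by positivity) (by linarith) hs.le
      have h2 := (one_add_norm_rpow_neg_le hs.le x y).trans (mul_le_mul_of_nonneg_right h1 hw)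
      calc M * (1 + ‖y‖) ^ (-s) ≤ M * (2 ^ s * (1 + ‖x‖) ^ (-s)) :=
            mul_le_mul_of_nonneg_left h2 hM
        _ = _ := by ring
    have hle : ‖z‖ ^ (2 - s) ≤ secondDiffMajorant s x z := by
      unfold secondDiffMajorant
      rw [Set.indicator_of_mem hz]
      have e1 : 0 ≤ (1 + ‖z‖) ^ (-s) := by positivity
      have e2 : 0 ≤ (1 + ‖x + z‖) ^ (-((n : ℝ) + 1)) := by positivity
      have e3 : 0 ≤ (1 + ‖x - z‖) ^ (-((n : ℝ) + 1)) := by positivity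
      linarith
    rcases eq_or_ne z 0 with rfl | hz'
    · have hpos : 0 ≤ secondDiffMajorant s x 0 := (Real.rpow_nonneg (norm_nonneg _) _).trans hle
      rw [norm_zero, Real.zero_rpow hs.ne', inv_zero, zero_mul]
      positivity
    · have hzp : 0 < ‖z‖ := norm_pos_iff.2 hz'
      calc (‖z‖ ^ s)⁻¹ * ‖secondDiff f x z‖
          ≤ (‖z‖ ^ s)⁻¹ * ((2 ^ s * M * (1 + ‖x‖) ^ (-s)) * ‖z‖ ^ 2) :=
            mul_le_mul_of_nonneg_left hsd (by positivity)
        _ = (2 ^ s * M * (1 + ‖x‖) ^ (-s)) * ‖z‖ ^ (2 - s) := by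
            rw [Real.rpow_sub hzp, Real.rpow_two]; ring
        _ ≤ _ := mul_le_mul_of_nonneg_left hle (by positivity)
  · have hz1 : 1 ≤ ‖z‖ := by simpa using hz
    have hinv : (‖z‖ ^ s)⁻¹ ≤ 2 ^ s * (1 + ‖z‖) ^ (-s) := by
      rw [Real.rpow_neg (by positivity), ← div_eq_mul_inv, inv_eq_one_div,
        div_le_div_iff₀ (by positivity) (by positivity), one_mul,
        ← Real.mul_rpow (by norm_num) (by positivity)]
      exact Real.rpow_le_rpow (by positivity) (by linarith) hs.le
    have hx0 : ‖f x‖ ≤ M * (1 + ‖x‖) ^ (-s) := (hf.norm_le x).trans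
      (mul_le_mul_of_nonneg_left (Real.rpow_le_rpow_of_exponent_le
        (by linarith [norm_nonneg x]) (by linarith [Nat.cast_nonneg (α := ℝ) n])) hM)
    have hsplit : ∀ w : EuclideanSpace ℝ (Fin n), ‖x - w‖ = ‖z‖ →
        (1 + ‖z‖) ^ (-s) * ‖f w‖ ≤
          M * (1 + ‖x‖) ^ (-s) * (1 + ‖w‖) ^ (-((n : ℝ) + 1)) := by
      intro w hw'
      have h1 := one_add_norm_rpow_neg_le hs.le x w
      rw [hw'] at h1
      have h2 : (1 + ‖z‖) ^ (-s) * (1 + ‖w‖) ^ (-s) ≤ (1 + ‖x‖) ^ (-s) := by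
        calc _ ≤ (1 + ‖z‖) ^ (-s) * ((1 + ‖z‖) ^ s * (1 + ‖x‖) ^ (-s)) :=
              mul_le_mul_of_nonneg_left h1 (by positivity)
          _ = (1 + ‖x‖) ^ (-s) := by
              rw [← mul_assoc, ← Real.rpow_add (by positivity), neg_add_cancel, Real.rpow_zero,
                one_mul]
      calc (1 + ‖z‖) ^ (-s) * ‖f w‖
          ≤ (1 + ‖z‖) ^ (-s) * (M * (1 + ‖w‖) ^ (-(s + n + 1))) :=
            mul_le_mul_of_nonneg_left (hf.norm_le w) (by positivity)
        _ = M * ((1 + ‖z‖) ^ (-s) * (1 + ‖w‖) ^ (-s)) * (1 + ‖w‖) ^ (-((n : ℝ) + 1)) := by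
            rw [show -(s + n + 1) = -s + -((n : ℝ) + 1) by ring, Real.rpow_add (by positivity)]
            ring
        _ ≤ _ := mul_le_mul_of_nonneg_right (mul_le_mul_of_nonneg_left h2 hM) (by positivity)
    have hp := hsplit (x + z) (by simp)
    have hm := hsplit (x - z) (by simp)
    have hsd : ‖secondDiff f x z‖ ≤ 2 * ‖f x‖ + ‖f (x + z)‖ + ‖f (x - z)‖ := by
      unfold secondDiff
      refine (norm_sub_le _ _).trans (add_le_add_left ((norm_sub_le _ _).trans_eq ?_) _)
      rw [norm_smul, Real.norm_ofNat]
    have h0 : (1 + ‖z‖) ^ (-s) * (2 * ‖f x‖) ≤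
        (M * (1 + ‖x‖) ^ (-s)) * (2 * (1 + ‖z‖) ^ (-s)) := by
      have := mul_le_mul_of_nonneg_left hx0 (show 0 ≤ 2 * (1 + ‖z‖) ^ (-s) by positivity)
      linarith
    calc (‖z‖ ^ s)⁻¹ * ‖secondDiff f x z‖
        ≤ (2 ^ s * (1 + ‖z‖) ^ (-s)) * (2 * ‖f x‖ + ‖f (x + z)‖ + ‖f (x - z)‖) :=
          mul_le_mul hinv hsd (norm_nonneg _) (by positivity)
      _ = 2 ^ s * ((1 + ‖z‖) ^ (-s) * (2 * ‖f x‖) + (1 + ‖z‖) ^ (-s) * ‖f (x + z)‖ +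
          (1 + ‖z‖) ^ (-s) * ‖f (x - z)‖) := by ring
      _ ≤ 2 ^ s * ((M * (1 + ‖x‖) ^ (-s)) * (2 * (1 + ‖z‖) ^ (-s)) +
          M * (1 + ‖x‖) ^ (-s) * (1 + ‖x + z‖) ^ (-((n : ℝ) + 1)) +
          M * (1 + ‖x‖) ^ (-s) * (1 + ‖x - z‖) ^ (-((n : ℝ) + 1))) :=
          mul_le_mul_of_nonneg_left (add_le_add (add_le_add h0 hp) hm) (by positivity)
      _ = _ := by
          unfold secondDiffMajorant
          rw [Set.indicator_of_notMem hz]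
          ring

/-! ### The fractional Laplacian as an absolutely convergent integral -/

/-- The integral `∫ (2 f(x) - f(x + z) - f(x - z)) / |z|^s dz`. For `s = n + α` it is
`2 / C_{n,α}` times the fractional Laplacian. -/
noncomputable def symFracLaplacian (s : ℝ) (f : EuclideanSpace ℝ (Fin n) → V)
    (x : EuclideanSpace ℝ (Fin n)) : V :=
  ∫ z, (‖z‖ ^ s)⁻¹ • secondDiff f x z

theorem aestronglyMeasurable_integrand {s : ℝ} {f : EuclideanSpace ℝ (Fin n) → V}
    (hf : Continuous f) (x : EuclideanSpace ℝ (Fin n)) :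
    AEStronglyMeasurable (fun z => (‖z‖ ^ s)⁻¹ • secondDiff f x z) volume := by
  refine AEStronglyMeasurable.smul (Measurable.aestronglyMeasurable (by fun_prop)) ?_
  unfold secondDiff
  exact Continuous.aestronglyMeasurable (by fun_prop)

theorem HasDecay.integrable_integrand (hn : 1 ≤ n) {s M : ℝ} (hs : n < s) (hs2 : s < n + 2)
    (hM : 0 ≤ M) {f : EuclideanSpace ℝ (Fin n) → V} (hf : HasDecay s M f)
    (x : EuclideanSpace ℝ (Fin n)) :
    Integrable (fun z => (‖z‖ ^ s)⁻¹ • secondDiff f x z) :=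
  ((integrable_secondDiffMajorant hn hs hs2 x).const_mul _).mono'
    (aestronglyMeasurable_integrand hf.contDiff.continuous x)
    (Eventually.of_forall (hf.norm_integrand_le ((Nat.cast_nonneg n).trans_lt hs) hM x))

theorem HasDecay.norm_symFracLaplacian_le (hn : 1 ≤ n) {s M : ℝ} (hs : n < s) (hs2 : s < n + 2)
    (hM : 0 ≤ M) {f : EuclideanSpace ℝ (Fin n) → V} (hf : HasDecay s M f)
    (x : EuclideanSpace ℝ (Fin n)) :
    ‖symFracLaplacian s f x‖ ≤ 2 ^ s * M * (1 + ‖x‖) ^ (-s) *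
      ∫ z, secondDiffMajorant s (0 : EuclideanSpace ℝ (Fin n)) z := by
  rw [← integral_secondDiffMajorant hn hs hs2 x, ← integral_const_mul]
  exact norm_integral_le_of_norm_le ((integrable_secondDiffMajorant hn hs hs2 x).const_mul _)
    (Eventually.of_forall (hf.norm_integrand_le ((Nat.cast_nonneg n).trans_lt hs) hM x))

end SecondDiff

section FracLaplacian

variable {n : ℕ} {α : ℝ}

theorem fracLaplacianConst_pos (n : ℕ) {α : ℝ} (hα0 : 0 < α) (hα2 : α < 2) :
    0 < fracLaplacianConst n α := by
  have h1 : 0 < Real.Gamma (((n : ℝ) + α) / 2) := Real.Gamma_pos_of_pos (by positivity)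
  have h2 : 0 < Real.Gamma (1 - α / 2) := Real.Gamma_pos_of_pos (by linarith)
  unfold fracLaplacianConst
  positivity

/-- Averaging the truncated integral with its reflection about `x` produces second differences. -/
theorem HasDecay.truncFracLaplacian_eq {M : ℝ} (hα0 : 0 < α) (hM : 0 ≤ M)
    {f : EuclideanSpace ℝ (Fin n) → ℝ} (hf : HasDecay ((n : ℝ) + α) M f)
    (x : EuclideanSpace ℝ (Fin n)) {ε : ℝ} (hε : 0 < ε) :
    truncFracLaplacian α f x ε = fracLaplacianConst n α / 2 *
      ∫ z, (Metric.ball 0 ε)ᶜ.indicator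
        (fun z => (‖z‖ ^ ((n : ℝ) + α))⁻¹ • secondDiff f x z) z := by
  have hcont : Continuous f := hf.contDiff.continuous
  have hms : MeasurableSet (Metric.ball x ε)ᶜ := Metric.isOpen_ball.measurableSet.compl
  set F : EuclideanSpace ℝ (Fin n) → ℝ := (Metric.ball x ε)ᶜ.indicator
    fun z => (f x - f z) / ‖x - z‖ ^ ((n : ℝ) + α) with hF
  have hbound : ∀ y, |f y| ≤ M := fun y => (hf.norm_le y).trans (mul_le_of_le_one_right hM
    (Real.rpow_le_one_of_one_le_of_nonpos (by linarith [norm_nonneg y])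
      (by linarith [Nat.cast_nonneg (α := ℝ) n])))
  have hint : Integrable F := by
    rw [hF, integrable_indicator_iff hms]
    obtain ⟨C, hC0, hC⟩ := exists_inv_norm_sub_rpow_le (n := n) (s := (n : ℝ) + α)
      (by positivity) hε x
    have hdom := ((integrable_inv_one_add_norm_rpow (n := n) (s := (n : ℝ) + α)
      (by linarith)).const_mul C).const_mul (M + M)
    refine hdom.integrableOn.mono' (Measurable.aestronglyMeasurable
      (Measurable.div (by fun_prop) (by fun_prop))) ?_
    filter_upwards [ae_restrict_mem hms] with z hz
    have hz' : ε ≤ ‖x - z‖ := by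
      rw [Set.mem_compl_iff, Metric.mem_ball, not_lt, dist_comm, dist_eq_norm] at hz
      exact hz
    rw [norm_div, Real.norm_of_nonneg (Real.rpow_nonneg (norm_nonneg (x - z)) _),
      div_eq_mul_one_div]
    have h1 : ‖f x - f z‖ ≤ M + M := (abs_sub _ _).trans (add_le_add (hbound x) (hbound z))
    have : 0 ≤ ‖x - z‖ ^ ((n : ℝ) + α) := Real.rpow_nonneg (norm_nonneg _) _
    exact mul_le_mul h1 (hC z hz') (by positivity) (by positivity)
  have e1 : ∫ z, F (x + z) = ∫ z, F z := integral_add_left_eq_self F x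
  have e2 : ∫ z, F (x - z) = ∫ z, F z := integral_sub_left_eq_self F volume x
  have e3 : (∫ z, F (x + z)) + ∫ z, F (x - z) = ∫ z, (Metric.ball 0 ε)ᶜ.indicator
        (fun z => (‖z‖ ^ ((n : ℝ) + α))⁻¹ • secondDiff f x z) z := by
    rw [← integral_add (hint.comp_add_left x) (hint.comp_sub_left x)]
    refine integral_congr_ae (Eventually.of_forall fun z => ?_)
    have m1 : x + z ∈ (Metric.ball x ε)ᶜ ↔ z ∈ (Metric.ball (0 : EuclideanSpace ℝ (Fin n)) ε)ᶜ := by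
      simp
    have m2 : x - z ∈ (Metric.ball x ε)ᶜ ↔ z ∈ (Metric.ball (0 : EuclideanSpace ℝ (Fin n)) ε)ᶜ := by
      simp
    by_cases hz : z ∈ (Metric.ball (0 : EuclideanSpace ℝ (Fin n)) ε)ᶜ
    · simp only [hF]
      rw [Set.indicator_of_mem (m1.2 hz), Set.indicator_of_mem (m2.2 hz),
        Set.indicator_of_mem hz, sub_add_cancel_left, norm_neg, sub_sub_cancel, secondDiff]
      simp only [smul_eq_mul]
      ring
    · simp only [hF]
      rw [Set.indicator_of_notMem (fun h => hz (m1.1 h)),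
        Set.indicator_of_notMem (fun h => hz (m2.1 h)), Set.indicator_of_notMem hz, add_zero]
  rw [← e3, e1, e2, truncFracLaplacian, ← integral_indicator hms]
  ring

/-- For decaying `C²` functions the principal value is an absolutely convergent integral. -/
theorem HasDecay.fracLaplacian_eq {M : ℝ} (hn : 1 ≤ n) (hα0 : 0 < α) (hα2 : α < 2) (hM : 0 ≤ M)
    {f : EuclideanSpace ℝ (Fin n) → ℝ} (hf : HasDecay ((n : ℝ) + α) M f)
    (x : EuclideanSpace ℝ (Fin n)) :
    fracLaplacian α f x = fracLaplacianConst n α / 2 * symFracLaplacian ((n : ℝ) + α) f x := by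
  refine Tendsto.limUnder_eq ?_
  have hlim : Tendsto (fun ε : ℝ => ∫ z, (Metric.ball 0 ε)ᶜ.indicator
      (fun z => (‖z‖ ^ ((n : ℝ) + α))⁻¹ • secondDiff f x z) z) (𝓝[>] 0)
      (𝓝 (symFracLaplacian ((n : ℝ) + α) f x)) := by
    have hI := hf.integrable_integrand hn (by linarith) (by linarith) hM x
    refine tendsto_integral_filter_of_dominated_convergence _
      (Eventually.of_forall fun ε => hI.aestronglyMeasurable.indicator
        Metric.isOpen_ball.measurableSet.compl)
      (Eventually.of_forall fun ε => Eventually.of_forall fun z => ?_) hI.norm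
      (Eventually.of_forall fun z => ?_)
    · exact norm_indicator_le_norm_self _ z
    · rcases eq_or_ne z 0 with rfl | hz
      · have h0 : (‖(0 : EuclideanSpace ℝ (Fin n))‖ ^ ((n : ℝ) + α))⁻¹ • secondDiff f x 0 = 0 := by
          simp [secondDiff, two_mul]
        refine Tendsto.congr (f₁ := fun _ => 0) (fun ε => ?_) (by rw [h0]; exact tendsto_const_nhds)
        by_cases hm : (0 : EuclideanSpace ℝ (Fin n)) ∈ (Metric.ball 0 ε)ᶜ
        · rw [Set.indicator_of_mem hm, h0]
        · rw [Set.indicator_of_notMem hm]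
      · refine tendsto_const_nhds.congr' ?_
        have : Set.Ioo 0 ‖z‖ ∈ 𝓝[>] (0 : ℝ) := Ioo_mem_nhdsGT (norm_pos_iff.2 hz)
        filter_upwards [this] with ε hε
        rw [Set.indicator_of_mem]
        simpa using hε.2.le
  refine (hlim.const_mul (fracLaplacianConst n α / 2)).congr' ?_
  filter_upwards [self_mem_nhdsWithin] with ε hε
  exact (hf.truncFracLaplacian_eq hα0 hM x hε).symm

/-- The weights `1 / (1 + |x|^(n+α))` and `(1 + |x|)^(-n-α)` are comparable. -/
theorem MemLAlpha.integrable_mul_weight (hα0 : 0 < α) {u : EuclideanSpace ℝ (Fin n) → ℝ}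
    (hu : MemLAlpha α u) : Integrable fun x => |u x| * (1 + ‖x‖) ^ (-((n : ℝ) + α)) := by
  refine (hu.2.const_mul 2).mono' (hu.1.norm.mul (Measurable.aestronglyMeasurable (by fun_prop)))
    (Eventually.of_forall fun x => ?_)
  have hx : 0 ≤ ‖x‖ ^ ((n : ℝ) + α) := Real.rpow_nonneg (norm_nonneg x) _
  rw [Real.norm_of_nonneg (by positivity), ← mul_div_assoc, mul_comm 2, mul_div_assoc]
  refine mul_le_mul_of_nonneg_left ?_ (abs_nonneg _)
  rw [Real.rpow_neg (by positivity), inv_eq_one_div, div_le_div_iff₀ (by positivity)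
    (by positivity), one_mul]
  exact one_add_rpow_ge (by positivity) (norm_nonneg x)

/-- Dominated convergence against a function in `L_α`. -/
theorem tendsto_integral_mul_of_weight_le (hα0 : 0 < α) {u : EuclideanSpace ℝ (Fin n) → ℝ}
    (hu : MemLAlpha α u) {ι : Type*} {l : Filter ι} [l.IsCountablyGenerated]
    {F : ι → EuclideanSpace ℝ (Fin n) → ℝ} {G : EuclideanSpace ℝ (Fin n) → ℝ} (C : ℝ)
    (hmeas : ∀ᶠ k in l, AEStronglyMeasurable (F k) volume)
    (hbound : ∀ᶠ k in l, ∀ x, |F k x| ≤ C * (1 + ‖x‖) ^ (-((n : ℝ) + α)))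
    (hlim : ∀ x, Tendsto (fun k => F k x) l (𝓝 (G x))) :
    Tendsto (fun k => ∫ x, u x * F k x) l (𝓝 (∫ x, u x * G x)) := by
  refine tendsto_integral_filter_of_dominated_convergence _ ?_ ?_
    ((hu.integrable_mul_weight hα0).const_mul C) (Eventually.of_forall fun x =>
      (hlim x).const_mul (u x))
  · filter_upwards [hmeas] with k hk
    exact hu.1.mul hk
  · filter_upwards [hbound] with k hk
    refine Eventually.of_forall fun x => ?_
    rw [norm_mul, Real.norm_eq_abs, Real.norm_eq_abs]
    calc |u x| * |F k x| ≤ |u x| * (C * (1 + ‖x‖) ^ (-((n : ℝ) + α))) :=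
          mul_le_mul_of_nonneg_left (hk x) (abs_nonneg _)
      _ = _ := by ring

theorem aestronglyMeasurable_symFracLaplacian {s : ℝ} {V : Type*} [NormedAddCommGroup V]
    [NormedSpace ℝ V] {f : EuclideanSpace ℝ (Fin n) → V} (hf : Continuous f) :
    AEStronglyMeasurable (symFracLaplacian s f) volume := by
  unfold symFracLaplacian
  refine AEStronglyMeasurable.integral_prod_right' (μ := volume) (ν := volume)
    (f := fun p : EuclideanSpace ℝ (Fin n) × EuclideanSpace ℝ (Fin n) =>
      (‖p.2‖ ^ s)⁻¹ • secondDiff f p.1 p.2) ?_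
  refine AEStronglyMeasurable.smul (Measurable.aestronglyMeasurable (by fun_prop)) ?_
  unfold secondDiff
  exact Continuous.aestronglyMeasurable (by fun_prop)

/-- Cutting off a Schwartz function at scale `k` keeps the decay uniform in `k`. -/
theorem SchwartzMap.exists_cutoff (f : SchwartzMap (EuclideanSpace ℝ (Fin n)) ℝ)
    (s : ℝ) : ∃ (M : ℝ) (F : ℕ → EuclideanSpace ℝ (Fin n) → ℝ), 0 ≤ M ∧
      (∀ k, ContDiff ℝ ∞ (F k)) ∧ (∀ k, HasCompactSupport (F k)) ∧ (∀ k, HasDecay s M (F k)) ∧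
      ∀ x, Tendsto (fun k => F k x) atTop (𝓝 (f x)) := by
  let χ : ContDiffBump (0 : EuclideanSpace ℝ (Fin n)) := ⟨1, 2, one_pos, one_lt_two⟩
  let X : SchwartzMap (EuclideanSpace ℝ (Fin n)) ℝ := χ.hasCompactSupport.toSchwartzMap χ.contDiff
  let c : ℕ → ℝ := fun k => ((k : ℝ) + 1)⁻¹
  have hc0 : ∀ k, 0 < c k := fun k => by positivity
  have hc1 : ∀ k, c k ≤ 1 := fun k => inv_le_one_of_one_le₀ (by
    linarith [Nat.cast_nonneg (α := ℝ) k])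
  have hct : Tendsto c atTop (𝓝 0) := by
    simpa [c, one_div] using tendsto_one_div_add_atTop_nhds_zero_nat (𝕜 := ℝ)
  have hχ : ∀ k, ContDiff ℝ ∞ fun x => χ (c k • x) := fun k =>
    χ.contDiff.comp (contDiff_const_smul (c k))
  have hB : ∀ i, ∃ B, 0 ≤ B ∧ ∀ k x, ‖iteratedFDeriv ℝ i (fun x => χ (c k • x)) x‖ ≤ B := by
    intro i
    refine ⟨SchwartzMap.seminorm ℝ 0 i X, by positivity, fun k x => ?_⟩
    rw [iteratedFDeriv_comp_const_smul _ χ.contDiff, norm_smul, norm_pow,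
      Real.norm_of_nonneg (hc0 k).le]
    exact (mul_le_of_le_one_left (norm_nonneg _) (pow_le_one₀ (hc0 k).le (hc1 k))).trans
      (SchwartzMap.norm_iteratedFDeriv_le_seminorm ℝ X i (c k • x))
  choose B hB0 hB using hB
  obtain ⟨M, hM, hfM⟩ := f.exists_hasDecay s
  have hD : ∀ j, ∃ D, 0 ≤ D ∧ ∀ y, ‖iteratedFDeriv ℝ j f y‖ ≤ D * (1 + ‖y‖) ^ (-s) :=
    fun j => f.exists_norm_iteratedFDeriv_le j s
  choose D hD0 hD using hD
  set M₂ := ∑ i ∈ Finset.range (2 + 1), ((2 : ℕ).choose i : ℝ) * B i * D (2 - i) with hM₂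
  have hM₂0 : 0 ≤ M₂ := Finset.sum_nonneg fun i _ =>
    mul_nonneg (mul_nonneg (Nat.cast_nonneg _) (hB0 i)) (hD0 _)
  refine ⟨max M M₂, fun k x => χ (c k • x) * f x, le_max_of_le_left hM,
    fun k => (hχ k).mul (f.smooth ⊤), fun k => ?_, fun k => ⟨?_, fun y => ?_, fun y => ?_⟩,
    fun x => ?_⟩
  · exact (χ.hasCompactSupport.comp_smul (hc0 k).ne').mul_right
  · exact ((hχ k).mul (f.smooth ⊤)).of_le (WithTop.coe_le_coe.2 le_top)
  · rw [norm_mul, Real.norm_of_nonneg χ.nonneg]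
    exact (mul_le_of_le_one_left (norm_nonneg _) χ.le_one).trans ((hfM.norm_le y).trans
      (mul_le_mul_of_nonneg_right (le_max_left _ _) (by positivity)))
  · refine (norm_iteratedFDeriv_mul_le (hχ k) (f.smooth ⊤) y (n := 2)
      (WithTop.coe_le_coe.2 le_top)).trans ?_
    refine le_trans ?_ (mul_le_mul_of_nonneg_right (le_max_right M M₂) (by positivity))
    rw [hM₂, Finset.sum_mul]
    refine Finset.sum_le_sum fun i _ => ?_
    rw [mul_assoc _ (D _)]
    exact mul_le_mul (mul_le_mul_of_nonneg_left (hB i k y) (Nat.cast_nonneg _)) (hD _ y)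
      (norm_nonneg _) (mul_nonneg (Nat.cast_nonneg _) (hB0 i))
  · have h1 : Tendsto (fun k => c k • x) atTop (𝓝 0) := by
      simpa using hct.smul_const x
    have h2 := ((χ.continuous.tendsto 0).comp h1).mul_const (f x)
    rwa [χ.one_of_mem_closedBall (Metric.mem_closedBall_self zero_le_one), one_mul] at h2

/-- Distributional `α`-harmonicity on the whole space can be tested against Schwartz functions. -/
theorem IsAlphaHarmonic.integral_mul_symFracLaplacian_eq_zero (hn : 1 ≤ n) (hα0 : 0 < α)
    (hα2 : α < 2) {u : EuclideanSpace ℝ (Fin n) → ℝ} (hu : IsAlphaHarmonic α u)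
    (f : SchwartzMap (EuclideanSpace ℝ (Fin n)) ℝ) :
    ∫ x, u x * symFracLaplacian ((n : ℝ) + α) f x = 0 := by
  have hs : (n : ℝ) < n + α := by linarith
  have hs2 : (n : ℝ) + α < n + 2 := by linarith
  obtain ⟨M, F, hM, hFs, hFc, hFd, hFt⟩ := f.exists_cutoff ((n : ℝ) + α)
  have hzero : ∀ k, ∫ x, u x * symFracLaplacian ((n : ℝ) + α) (F k) x = 0 := by
    intro k
    have h := hu.2 (F k) (hFs k) (hFc k) (Set.subset_univ _)
    have hC := fracLaplacianConst_pos n hα0 hα2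
    simp_rw [(hFd k).fracLaplacian_eq hn hα0 hα2 hM, mul_left_comm (u _)] at h
    rw [integral_const_mul] at h
    exact (mul_eq_zero.1 h).resolve_left (by positivity)
  have hlim : ∀ x, Tendsto (fun k => symFracLaplacian ((n : ℝ) + α) (F k) x) atTop
      (𝓝 (symFracLaplacian ((n : ℝ) + α) f x)) := by
    intro x
    refine tendsto_integral_filter_of_dominated_convergence _
      (Eventually.of_forall fun k =>
        aestronglyMeasurable_integrand (hFd k).contDiff.continuous x)
      (Eventually.of_forall fun k => Eventually.of_forall
        ((hFd k).norm_integrand_le (by positivity) hM x))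
      ((integrable_secondDiffMajorant hn hs hs2 x).const_mul _)
      (Eventually.of_forall fun z => ?_)
    exact ((((hFt x).const_smul (2 : ℝ)).sub (hFt (x + z))).sub (hFt (x - z))).const_smul _
  have h := tendsto_integral_mul_of_weight_le hα0 hu.1 (l := atTop)
    (F := fun k => symFracLaplacian ((n : ℝ) + α) (F k))
    (2 ^ ((n : ℝ) + α) * M *
      ∫ z, secondDiffMajorant ((n : ℝ) + α) (0 : EuclideanSpace ℝ (Fin n)) z)
    (Eventually.of_forall fun k => aestronglyMeasurable_symFracLaplacian
      (hFd k).contDiff.continuous)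
    (Eventually.of_forall fun k x => ((hFd k).norm_symFracLaplacian_le hn hs hs2 hM x).trans_eq
      (by ring)) hlim
  simp_rw [hzero] at h
  exact tendsto_nhds_unique h tendsto_const_nhds

end FracLaplacian

/-! ### The Fourier symbol -/

section Symbol

variable {n : ℕ} {α s : ℝ}

/-- The Fourier symbol `∫ (2 - 2 cos(2π⟨ξ, z⟩)) / |z|^s dz` of the operator `symFracLaplacian s`. -/
noncomputable def fracSymbol (s : ℝ) (ξ : EuclideanSpace ℝ (Fin n)) : ℝ :=
  ∫ z, (‖z‖ ^ s)⁻¹ * (2 - 2 * Real.cos (2 * Real.pi * inner ℝ ξ z))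

/-- An integrable function of `z` which dominates the integrand of the symbol. -/
noncomputable def symbolMajorant (s : ℝ) (z : EuclideanSpace ℝ (Fin n)) : ℝ :=
  (Metric.ball 0 1).indicator (fun z => ‖z‖ ^ (2 - s)) z + (1 + ‖z‖) ^ (-s)

theorem integrable_symbolMajorant (hn : 1 ≤ n) (hs : n < s) (hs2 : s < n + 2) :
    Integrable (symbolMajorant (n := n) s) :=
  (integrable_indicator_norm_rpow hn hs2).add (integrable_one_add_norm_rpow hs)

theorem symbol_integrand_nonneg (ξ z : EuclideanSpace ℝ (Fin n)) :
    0 ≤ (‖z‖ ^ s)⁻¹ * (2 - 2 * Real.cos (2 * Real.pi * inner ℝ ξ z)) := by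
  have := Real.cos_le_one (2 * Real.pi * inner ℝ ξ z)
  have := Real.rpow_nonneg (norm_nonneg z) s
  exact mul_nonneg (by positivity) (by linarith)

/-- The bound `2 - 2 cos t ≤ min(4, t²)`, used with `t²` for `|z| < 1` and with `4` for
`|z| ≥ 1`. -/
theorem symbol_integrand_le (hs : 0 < s) (ξ z : EuclideanSpace ℝ (Fin n)) :
    (‖z‖ ^ s)⁻¹ * (2 - 2 * Real.cos (2 * Real.pi * inner ℝ ξ z)) ≤
      (4 * Real.pi ^ 2 + 4 * 2 ^ s) * (1 + ‖ξ‖) ^ 2 * symbolMajorant s z := by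
  have hz0 : 0 ≤ ‖z‖ ^ s := Real.rpow_nonneg (norm_nonneg z) s
  have hξ : 1 ≤ (1 + ‖ξ‖) ^ 2 := one_le_pow₀ (by linarith [norm_nonneg ξ])
  have hξ2 : ‖ξ‖ ^ 2 ≤ (1 + ‖ξ‖) ^ 2 :=
    pow_le_pow_left₀ (norm_nonneg ξ) (by linarith) 2
  have hw : 0 ≤ (1 + ‖z‖) ^ (-s) := by positivity
  have h2s : (0 : ℝ) ≤ 2 ^ s := by positivity
  unfold symbolMajorant
  by_cases hz : z ∈ Metric.ball (0 : EuclideanSpace ℝ (Fin n)) 1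
  · rw [Set.indicator_of_mem hz]
    have hq : 0 ≤ ‖z‖ ^ (2 - s) := Real.rpow_nonneg (norm_nonneg z) _
    rcases eq_or_ne z 0 with rfl | hz'
    · rw [inner_zero_right, mul_zero, Real.cos_zero, mul_one, sub_self, mul_zero]
      positivity
    have hzp : 0 < ‖z‖ := norm_pos_iff.2 hz'
    have hcos := Real.one_sub_sq_div_two_le_cos (x := 2 * Real.pi * inner ℝ ξ z)
    have hin : (inner ℝ ξ z : ℝ) ^ 2 ≤ ‖ξ‖ ^ 2 * ‖z‖ ^ 2 := by
      rw [← mul_pow, ← sq_abs]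
      exact pow_le_pow_left₀ (abs_nonneg _) (abs_real_inner_le_norm ξ z) 2
    have h1 : 2 - 2 * Real.cos (2 * Real.pi * inner ℝ ξ z) ≤
        4 * Real.pi ^ 2 * ((1 + ‖ξ‖) ^ 2 * ‖z‖ ^ 2) := by
      have h3 : (inner ℝ ξ z : ℝ) ^ 2 ≤ (1 + ‖ξ‖) ^ 2 * ‖z‖ ^ 2 :=
        hin.trans (mul_le_mul_of_nonneg_right hξ2 (by positivity))
      have h4 := mul_le_mul_of_nonneg_left h3 (show 0 ≤ 4 * Real.pi ^ 2 by positivity)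
      linarith
    calc _ ≤ (‖z‖ ^ s)⁻¹ * (4 * Real.pi ^ 2 * ((1 + ‖ξ‖) ^ 2 * ‖z‖ ^ 2)) :=
          mul_le_mul_of_nonneg_left h1 (by positivity)
      _ = 4 * Real.pi ^ 2 * (1 + ‖ξ‖) ^ 2 * ‖z‖ ^ (2 - s) := by
          rw [Real.rpow_sub hzp, Real.rpow_two]; ring
      _ ≤ _ := mul_le_mul (mul_le_mul_of_nonneg_right (by linarith) (by positivity))
          (by linarith) hq (by positivity)
  · rw [Set.indicator_of_notMem hz, zero_add]
    have hz1 : 1 ≤ ‖z‖ := by simpa using hz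
    have hinv : (‖z‖ ^ s)⁻¹ ≤ 2 ^ s * (1 + ‖z‖) ^ (-s) := by
      rw [Real.rpow_neg (by positivity), ← div_eq_mul_inv, inv_eq_one_div,
        div_le_div_iff₀ (by positivity) (by positivity), one_mul,
        ← Real.mul_rpow (by norm_num) (by positivity)]
      exact Real.rpow_le_rpow (by positivity) (by linarith) hs.le
    have hcos := Real.neg_one_le_cos (2 * Real.pi * inner ℝ ξ z)
    calc _ ≤ (2 ^ s * (1 + ‖z‖) ^ (-s)) * 4 :=
          mul_le_mul hinv (by linarith) (by linarith [Real.cos_le_one (2 * Real.pi * inner ℝ ξ z)])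
            (by positivity)
      _ = (4 * 2 ^ s) * 1 * (1 + ‖z‖) ^ (-s) := by ring
      _ ≤ _ := mul_le_mul_of_nonneg_right
          (mul_le_mul (by nlinarith [sq_nonneg Real.pi]) hξ zero_le_one (by positivity)) hw

theorem integrable_symbol_integrand (hn : 1 ≤ n) (hs : n < s) (hs2 : s < n + 2)
    (ξ : EuclideanSpace ℝ (Fin n)) :
    Integrable fun z => (‖z‖ ^ s)⁻¹ * (2 - 2 * Real.cos (2 * Real.pi * inner ℝ ξ z)) := by
  refine ((integrable_symbolMajorant hn hs hs2).const_mul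
    ((4 * Real.pi ^ 2 + 4 * 2 ^ s) * (1 + ‖ξ‖) ^ 2)).mono'
    (Measurable.aestronglyMeasurable (by fun_prop)) (Eventually.of_forall fun z => ?_)
  rw [Real.norm_of_nonneg (symbol_integrand_nonneg ξ z)]
  exact symbol_integrand_le ((Nat.cast_nonneg n).trans_lt hs) ξ z

theorem fracSymbol_map (R : EuclideanSpace ℝ (Fin n) ≃ₗᵢ[ℝ] EuclideanSpace ℝ (Fin n))
    (ξ : EuclideanSpace ℝ (Fin n)) : fracSymbol s (R ξ) = fracSymbol s ξ := by
  unfold fracSymbol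
  rw [← R.measurePreserving.integral_comp R.toHomeomorph.measurableEmbedding]
  simp

theorem fracSymbol_smul {t : ℝ} (ht : 0 < t) (ξ : EuclideanSpace ℝ (Fin n)) :
    fracSymbol s (t • ξ) = t ^ (s - n) * fracSymbol s ξ := by
  unfold fracSymbol
  have h := Measure.integral_comp_smul (volume : Measure (EuclideanSpace ℝ (Fin n)))
    (fun z => (‖z‖ ^ s)⁻¹ * (2 - 2 * Real.cos (2 * Real.pi * inner ℝ ξ z))) t
  rw [finrank_euclideanSpace_fin, abs_of_pos (by positivity), smul_eq_mul] at h
  rw [Real.rpow_sub ht, Real.rpow_natCast, div_eq_mul_inv, mul_assoc, ← h,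
    ← integral_const_mul]
  refine integral_congr_ae (Eventually.of_forall fun z => ?_)
  have hts : t ^ s ≠ 0 := (Real.rpow_pos_of_pos ht s).ne'
  simp only
  rw [norm_smul, Real.norm_of_nonneg ht.le, Real.mul_rpow ht.le (norm_nonneg z),
    real_inner_smul_left, real_inner_smul_right, mul_inv, mul_assoc (t ^ s)⁻¹,
    mul_inv_cancel_left₀ hts]

theorem fracSymbol_pos (hn : 1 ≤ n) (hs : n < s) (hs2 : s < n + 2)
    {ξ : EuclideanSpace ℝ (Fin n)} (hξ : ‖ξ‖ = 1) : 0 < fracSymbol s ξ := by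
  unfold fracSymbol
  rw [integral_pos_iff_support_of_nonneg (symbol_integrand_nonneg ξ)
    (integrable_symbol_integrand hn hs hs2 ξ)]
  have hU : IsOpen {z : EuclideanSpace ℝ (Fin n) |
      Real.cos (2 * Real.pi * inner ℝ ξ z) < 1} := isOpen_lt (by fun_prop) (by fun_prop)
  have hne : {z : EuclideanSpace ℝ (Fin n) |
      Real.cos (2 * Real.pi * inner ℝ ξ z) < 1}.Nonempty := by
    refine ⟨(1 / 4 : ℝ) • ξ, ?_⟩
    have : 2 * Real.pi * inner ℝ ξ ((1 / 4 : ℝ) • ξ) = Real.pi / 2 := by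
      rw [real_inner_smul_right, real_inner_self_eq_norm_sq, hξ]; ring
    change Real.cos (2 * Real.pi * inner ℝ ξ ((1 / 4 : ℝ) • ξ)) < 1
    rw [this, Real.cos_pi_div_two]
    exact zero_lt_one
  refine (hU.measure_pos volume hne).trans_le (measure_mono fun z hz => ?_)
  have hz' : Real.cos (2 * Real.pi * inner ℝ ξ z) < 1 := hz
  have hz0 : z ≠ 0 := by
    rintro rfl
    simp at hz'
  have h1 : 0 < ‖z‖ ^ s := Real.rpow_pos_of_pos (norm_pos_iff.2 hz0) s
  exact (mul_pos (inv_pos.2 h1) (by linarith)).ne'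

/-- By rotation invariance and scaling, the symbol is a positive multiple of `|ξ|^α`. -/
theorem exists_fracSymbol_eq (hn : 1 ≤ n) (hα0 : 0 < α) (hα2 : α < 2) :
    ∃ κ, 0 < κ ∧ ∀ ξ : EuclideanSpace ℝ (Fin n),
      fracSymbol ((n : ℝ) + α) ξ = κ * ‖ξ‖ ^ α := by
  set e : EuclideanSpace ℝ (Fin n) := EuclideanSpace.single ⟨0, hn⟩ 1
  have he : ‖e‖ = 1 := by simp [e]
  refine ⟨fracSymbol ((n : ℝ) + α) e, fracSymbol_pos hn (by linarith) (by linarith) he,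
    fun ξ => ?_⟩
  rcases eq_or_ne ξ 0 with rfl | hξ
  · simp [fracSymbol, Real.zero_rpow hα0.ne']
  -- a reflection carries the unit vector `e` to `ξ / |ξ|`
  · have hξ' : 0 < ‖ξ‖ := norm_pos_iff.2 hξ
    have hn' : ‖e‖ = ‖‖ξ‖⁻¹ • ξ‖ := by
      rw [he, norm_smul, norm_inv, norm_norm, inv_mul_cancel₀ hξ'.ne']
    have h1 := fracSymbol_map (s := (n : ℝ) + α)
      (Submodule.reflection (Submodule.span ℝ {e - ‖ξ‖⁻¹ • ξ})ᗮ) e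
    rw [Submodule.reflection_sub hn'] at h1
    have h2 := fracSymbol_smul (s := (n : ℝ) + α) hξ' (‖ξ‖⁻¹ • ξ)
    rw [smul_inv_smul₀ hξ'.ne', h1, add_sub_cancel_left] at h2
    rw [h2, mul_comm]

theorem secondDiff_exp (a b : ℝ) :
    2 * Complex.exp (a * Complex.I) - Complex.exp ((a + b : ℝ) * Complex.I) -
      Complex.exp ((a - b : ℝ) * Complex.I) =
      ((2 - 2 * Real.cos b : ℝ) : ℂ) * Complex.exp (a * Complex.I) := by
  push_cast
  rw [add_mul, sub_mul, Complex.exp_add, sub_eq_add_neg (_ * Complex.I), Complex.exp_add,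
    Complex.cos, neg_mul]
  ring

/-- On an inverse Fourier transform, `symFracLaplacian s` acts as multiplication by the symbol. -/
theorem symFracLaplacian_fourierInv (hn : 1 ≤ n) (hs : n < s) (hs2 : s < n + 2)
    (p : SchwartzMap (EuclideanSpace ℝ (Fin n)) ℂ) (y : EuclideanSpace ℝ (Fin n)) :
    symFracLaplacian s (FourierTransformInv.fourierInv p) y =
      ∫ ξ, Complex.exp ((2 * Real.pi * inner ℝ ξ y : ℝ) * Complex.I) *
        ((fracSymbol s ξ : ℂ) * p ξ) := by
  have hs0 : 0 < s := (Nat.cast_nonneg n).trans_lt hs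
  have hval : ∀ w, (FourierTransformInv.fourierInv p) w =
      ∫ ξ, Complex.exp ((2 * Real.pi * inner ℝ ξ w : ℝ) * Complex.I) * p ξ := by
    intro w
    rw [SchwartzMap.fourierInv_coe, Real.fourierInv_eq']
    simp only [smul_eq_mul]
  have hnorm : ∀ t : ℝ, ‖Complex.exp (t * Complex.I)‖ = 1 := Complex.norm_exp_ofReal_mul_I
  have hint : ∀ w, Integrable fun ξ : EuclideanSpace ℝ (Fin n) =>
      Complex.exp ((2 * Real.pi * inner ℝ ξ w : ℝ) * Complex.I) * p ξ := by
    intro w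
    refine p.integrable.norm.mono' (Continuous.aestronglyMeasurable (by fun_prop))
      (Eventually.of_forall fun ξ => ?_)
    rw [norm_mul, hnorm, one_mul]
  have hsd : ∀ z, (‖z‖ ^ s)⁻¹ • secondDiff (FourierTransformInv.fourierInv p) y z =
      ∫ ξ, (((‖z‖ ^ s)⁻¹ * (2 - 2 * Real.cos (2 * Real.pi * inner ℝ ξ z)) : ℝ) : ℂ) *
        (Complex.exp ((2 * Real.pi * inner ℝ ξ y : ℝ) * Complex.I) * p ξ) := by
    intro z
    have h2 : Integrable fun ξ : EuclideanSpace ℝ (Fin n) =>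
        (2 : ℝ) • (Complex.exp ((2 * Real.pi * inner ℝ ξ y : ℝ) * Complex.I) * p ξ) :=
      (hint y).smul (2 : ℝ)
    have h3 : Integrable fun ξ : EuclideanSpace ℝ (Fin n) =>
        (2 : ℝ) • (Complex.exp ((2 * Real.pi * inner ℝ ξ y : ℝ) * Complex.I) * p ξ) -
          Complex.exp ((2 * Real.pi * inner ℝ ξ (y + z) : ℝ) * Complex.I) * p ξ :=
      h2.sub (hint (y + z))
    rw [secondDiff, hval, hval, hval, ← integral_smul, ← integral_sub h2 (hint (y + z)),
      ← integral_sub h3 (hint (y - z)), ← integral_smul]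
    refine integral_congr_ae (Eventually.of_forall fun ξ => ?_)
    have h := secondDiff_exp (2 * Real.pi * inner ℝ ξ y) (2 * Real.pi * inner ℝ ξ z)
    simp only [inner_add_right, inner_sub_right, mul_add, mul_sub, Complex.real_smul] at h ⊢
    push_cast at h ⊢
    linear_combination ((‖z‖ ^ s : ℝ) : ℂ)⁻¹ * p ξ * h
  obtain ⟨M, hM, hpM⟩ := p.exists_norm_iteratedFDeriv_le 0 ((n : ℝ) + 3)
  have hpI : Integrable fun ξ => (1 + ‖ξ‖) ^ 2 * ‖p ξ‖ := by
    refine ((integrable_one_add_norm_rpow (n := n) (s := (n : ℝ) + 1) (by linarith)).const_mul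
      M).mono' (Continuous.aestronglyMeasurable (by fun_prop)) (Eventually.of_forall fun ξ => ?_)
    have h := hpM ξ
    rw [norm_iteratedFDeriv_zero] at h
    rw [Real.norm_of_nonneg (by positivity)]
    calc _ ≤ (1 + ‖ξ‖) ^ 2 * (M * (1 + ‖ξ‖) ^ (-((n : ℝ) + 3))) :=
          mul_le_mul_of_nonneg_left h (by positivity)
      _ = _ := by
          rw [show -((n : ℝ) + 1) = 2 + -((n : ℝ) + 3) by ring,
            Real.rpow_add (by positivity), Real.rpow_two]
          ring
  -- absolute integrability in `(z, ξ)`, so that the order of integration can be exchanged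
  have hFub : Integrable (Function.uncurry fun z ξ : EuclideanSpace ℝ (Fin n) =>
      (((‖z‖ ^ s)⁻¹ * (2 - 2 * Real.cos (2 * Real.pi * inner ℝ ξ z)) : ℝ) : ℂ) *
        (Complex.exp ((2 * Real.pi * inner ℝ ξ y : ℝ) * Complex.I) * p ξ))
      (volume.prod volume) := by
    refine (((integrable_symbolMajorant hn hs hs2).mul_prod hpI).const_mul
      (4 * Real.pi ^ 2 + 4 * 2 ^ s)).mono' ?_ (Eventually.of_forall fun q => ?_)
    · refine AEStronglyMeasurable.mul (Measurable.aestronglyMeasurable (by fun_prop))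
        (Continuous.aestronglyMeasurable ?_)
      have := p.continuous
      fun_prop
    · simp only [Function.uncurry]
      rw [norm_mul, norm_mul, hnorm, one_mul, Complex.norm_real,
        Real.norm_of_nonneg (symbol_integrand_nonneg _ _)]
      refine (mul_le_mul_of_nonneg_right (symbol_integrand_le hs0 q.2 q.1)
        (norm_nonneg _)).trans_eq ?_
      ring
  rw [symFracLaplacian]
  simp_rw [hsd]
  rw [integral_integral_swap hFub]
  refine integral_congr_ae (Eventually.of_forall fun ξ => ?_)
  simp only
  rw [integral_mul_const, integral_complex_ofReal, fracSymbol]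
  ring

end Symbol

/-! ### Low-pass kernels -/

section LowPass

variable {n : ℕ} {α : ℝ}

/-- A smooth bump function equal to `1` on the unit ball and supported in the ball of radius `2`. -/
def lowPassBump (n : ℕ) : ContDiffBump (0 : EuclideanSpace ℝ (Fin n)) :=
  ⟨1, 2, one_pos, one_lt_two⟩

theorem lowPassBump_eq_one {ξ : EuclideanSpace ℝ (Fin n)} (hξ : ‖ξ‖ ≤ 1) :
    lowPassBump n ξ = 1 :=
  (lowPassBump n).one_of_mem_closedBall (by simpa [lowPassBump] using hξ)

theorem contDiff_ofReal_lowPassBump :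
    ContDiff ℝ ∞ fun ξ : EuclideanSpace ℝ (Fin n) => (lowPassBump n ξ : ℂ) :=
  Complex.ofRealCLM.contDiff.comp (lowPassBump n).contDiff

theorem hasCompactSupport_ofReal_lowPassBump :
    HasCompactSupport fun ξ : EuclideanSpace ℝ (Fin n) => (lowPassBump n ξ : ℂ) :=
  (lowPassBump n).hasCompactSupport.comp_left Complex.ofReal_zero

/-- The bump function `lowPassBump` as a complex-valued Schwartz function. -/
noncomputable def lowPassSymbol (n : ℕ) : SchwartzMap (EuclideanSpace ℝ (Fin n)) ℂ :=
  hasCompactSupport_ofReal_lowPassBump.toSchwartzMap contDiff_ofReal_lowPassBump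

/-- The real part of the inverse Fourier transform of the bump function. -/
noncomputable def lowPassKernel (n : ℕ) : SchwartzMap (EuclideanSpace ℝ (Fin n)) ℝ :=
  SchwartzMap.postcompCLM Complex.reCLM (FourierTransformInv.fourierInv (lowPassSymbol n))

/-- The dilates `R^(-n) K(y / R)` of the low-pass kernel `K`. -/
noncomputable def scaledKernel (R : ℝ) (y : EuclideanSpace ℝ (Fin n)) : ℝ :=
  (R ^ n)⁻¹ * lowPassKernel n (R⁻¹ • y)

theorem continuous_scaledKernel (R : ℝ) : Continuous (scaledKernel (n := n) R) := by
  have := (lowPassKernel n).continuous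
  unfold scaledKernel
  fun_prop

theorem scaledKernel_eq_re_integral {R : ℝ} (hR : 0 < R) (y : EuclideanSpace ℝ (Fin n)) :
    scaledKernel R y = (∫ ξ : EuclideanSpace ℝ (Fin n),
      Complex.exp ((2 * Real.pi * inner ℝ ξ y : ℝ) * Complex.I) *
        (lowPassBump n (R • ξ) : ℂ)).re := by
  have h := Measure.integral_comp_smul (volume : Measure (EuclideanSpace ℝ (Fin n)))
    (fun ξ => Complex.exp ((2 * Real.pi * inner ℝ ξ (R⁻¹ • y) : ℝ) * Complex.I) *
      (lowPassBump n ξ : ℂ)) R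
  simp only [real_inner_smul_left, real_inner_smul_right, inv_mul_cancel_left₀ hR.ne'] at h
  rw [h, finrank_euclideanSpace_fin, abs_of_pos (by positivity), Complex.smul_re, smul_eq_mul,
    scaledKernel, lowPassKernel, SchwartzMap.postcompCLM_apply, Complex.reCLM_apply,
    SchwartzMap.fourierInv_coe, Real.fourierInv_eq']
  simp only [real_inner_smul_right, smul_eq_mul]
  rfl

theorem integral_lowPassKernel : ∫ y, lowPassKernel n y = 1 := by
  have h1 : ∫ y, (FourierTransformInv.fourierInv (lowPassSymbol n)) y = 1 := by
    have h0 : FourierTransform.fourier (FourierTransformInv.fourierInv (lowPassSymbol n) :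
        SchwartzMap (EuclideanSpace ℝ (Fin n)) ℂ) = lowPassSymbol n :=
      FourierTransform.fourier_fourierInv_eq _
    have h := congrArg (fun f : SchwartzMap (EuclideanSpace ℝ (Fin n)) ℂ => f 0) h0
    simp only [SchwartzMap.fourier_coe, Real.fourier_eq', inner_zero_right, mul_zero,
      Complex.ofReal_zero, zero_mul, Complex.exp_zero, one_smul] at h
    rw [h]
    change ((lowPassBump n (0 : EuclideanSpace ℝ (Fin n)) : ℝ) : ℂ) = 1
    rw [lowPassBump_eq_one (by simp), Complex.ofReal_one]
  have h2 := integral_re (SchwartzMap.integrable (μ := volume)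
    (FourierTransformInv.fourierInv (lowPassSymbol n)))
  rw [h1] at h2
  simpa [lowPassKernel, SchwartzMap.postcompCLM_apply] using h2

/-- The difference of two translated low-pass kernels has a Fourier transform supported away from
the origin; dividing it by the symbol exhibits it as the fractional Laplacian of a Schwartz
function. -/
theorem exists_symFracLaplacian_eq_scaledKernel_sub (hn : 1 ≤ n) (hα0 : 0 < α) (hα2 : α < 2)
    {R R' : ℝ} (hR : 0 < R) (hR' : 0 < R') (x : EuclideanSpace ℝ (Fin n)) :
    ∃ f : SchwartzMap (EuclideanSpace ℝ (Fin n)) ℝ, ∀ y,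
      symFracLaplacian ((n : ℝ) + α) f y = scaledKernel R (y - x) - scaledKernel R' (y - x) := by
  obtain ⟨κ, hκ, hsym⟩ := exists_fracSymbol_eq hn hα0 hα2
  have hs : (n : ℝ) < n + α := by linarith
  have hs2 : (n : ℝ) + α < n + 2 := by linarith
  let D : EuclideanSpace ℝ (Fin n) → ℂ := fun ξ =>
    (lowPassBump n (R • ξ) : ℂ) - (lowPassBump n (R' • ξ) : ℂ)
  let E : EuclideanSpace ℝ (Fin n) → ℂ := fun ξ =>
    Complex.exp ((-(2 * Real.pi * inner ℝ ξ x) : ℝ) * Complex.I)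
  let P : EuclideanSpace ℝ (Fin n) → ℂ := fun ξ => D ξ * E ξ * (((κ * ‖ξ‖ ^ α)⁻¹ : ℝ) : ℂ)
  have hmR : ∀ {R : ℝ}, 0 < R → HasCompactSupport fun ξ : EuclideanSpace ℝ (Fin n) =>
      (lowPassBump n (R • ξ) : ℂ) := fun hR =>
    hasCompactSupport_ofReal_lowPassBump.comp_smul hR.ne'
  have hmR' : ∀ R : ℝ, ContDiff ℝ ∞ fun ξ : EuclideanSpace ℝ (Fin n) =>
      (lowPassBump n (R • ξ) : ℂ) := fun R =>
    contDiff_ofReal_lowPassBump.comp (contDiff_const_smul R)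
  have hDc : HasCompactSupport D := (hmR hR).sub (hmR hR')
  have hDs : ContDiff ℝ ∞ D := (hmR' R).sub (hmR' R')
  have hEs : ContDiff ℝ ∞ E := by
    refine Complex.contDiff_exp.comp (ContDiff.mul (Complex.ofRealCLM.contDiff.comp ?_)
      contDiff_const)
    exact (contDiff_const.mul (contDiff_id.inner ℝ contDiff_const)).neg
  have hD0 : D =ᶠ[𝓝 0] 0 := by
    have hnear : ∀ R : ℝ, ∀ᶠ ξ : EuclideanSpace ℝ (Fin n) in 𝓝 0, ‖R • ξ‖ ≤ 1 := by
      intro R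
      have : Tendsto (fun ξ : EuclideanSpace ℝ (Fin n) => ‖R • ξ‖) (𝓝 0) (𝓝 0) := by
        have hc : Continuous fun ξ : EuclideanSpace ℝ (Fin n) => ‖R • ξ‖ := by fun_prop
        simpa using hc.tendsto 0
      exact (this.eventually (gt_mem_nhds zero_lt_one)).mono fun ξ h => h.le
    filter_upwards [hnear R, hnear R'] with ξ h1 h2
    simp only [D, lowPassBump_eq_one h1, lowPassBump_eq_one h2, sub_self, Pi.zero_apply]
  have hPs : ContDiff ℝ ∞ P := by
    rw [contDiff_iff_contDiffAt]
    intro ξ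
    rcases eq_or_ne ξ 0 with rfl | hξ
    -- near the origin both bumps equal `1`, so the quotient by `|ξ|^α` vanishes identically
    · have : P =ᶠ[𝓝 0] fun _ => 0 := by
        filter_upwards [hD0] with ξ h
        simp only [P, h, Pi.zero_apply, zero_mul]
      exact contDiffAt_const.congr_of_eventuallyEq this
    · refine (hDs.contDiffAt.mul hEs.contDiffAt).mul
        (Complex.ofRealCLM.contDiff.contDiffAt.comp ξ (ContDiffAt.inv (contDiffAt_const.mul
          ((contDiffAt_norm ℝ hξ).rpow_const_of_ne (norm_ne_zero_iff.2 hξ))) ?_))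
      have : 0 < ‖ξ‖ := norm_pos_iff.2 hξ
      positivity
  have hPc : HasCompactSupport P := (hDc.mul_right).mul_right
  let p : SchwartzMap (EuclideanSpace ℝ (Fin n)) ℂ := hPc.toSchwartzMap hPs
  set ψ := FourierTransformInv.fourierInv p with hψ
  refine ⟨SchwartzMap.postcompCLM Complex.reCLM ψ, fun y => ?_⟩
  have hcomplex : symFracLaplacian ((n : ℝ) + α) ψ y =
      (∫ ξ : EuclideanSpace ℝ (Fin n),
        Complex.exp ((2 * Real.pi * inner ℝ ξ (y - x) : ℝ) * Complex.I) *
          (lowPassBump n (R • ξ) : ℂ)) - ∫ ξ : EuclideanSpace ℝ (Fin n),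
        Complex.exp ((2 * Real.pi * inner ℝ ξ (y - x) : ℝ) * Complex.I) *
          (lowPassBump n (R' • ξ) : ℂ) := by
    have hI : ∀ {R : ℝ}, 0 < R → Integrable fun ξ : EuclideanSpace ℝ (Fin n) =>
        Complex.exp ((2 * Real.pi * inner ℝ ξ (y - x) : ℝ) * Complex.I) *
          (lowPassBump n (R • ξ) : ℂ) := by
      intro R hR
      have := (hmR' R).continuous
      exact Continuous.integrable_of_hasCompactSupport (by fun_prop) (hmR hR).mul_left
    rw [symFracLaplacian_fourierInv hn hs hs2, ← integral_sub (hI hR) (hI hR')]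
    refine integral_congr_ae (Eventually.of_forall fun ξ => ?_)
    change Complex.exp ((2 * Real.pi * inner ℝ ξ y : ℝ) * Complex.I) *
      ((fracSymbol ((n : ℝ) + α) ξ : ℂ) * (D ξ * E ξ * (((κ * ‖ξ‖ ^ α)⁻¹ : ℝ) : ℂ))) = _
    have hE : Complex.exp ((2 * Real.pi * inner ℝ ξ (y - x) : ℝ) * Complex.I) =
        Complex.exp ((2 * Real.pi * inner ℝ ξ y : ℝ) * Complex.I) * E ξ := by
      simp only [E]
      rw [← Complex.exp_add, inner_sub_right]
      congr 1
      push_cast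
      ring
    beta_reduce
    rw [hsym, ← mul_sub, hE]
    change _ = _ * D ξ
    -- at `ξ = 0`, where the inverse of the symbol has a junk value, the factor `D` vanishes
    rcases eq_or_ne ξ 0 with rfl | hξ
    · rw [hD0.eq_of_nhds]
      simp
    · have h0 : 0 < κ * ‖ξ‖ ^ α := mul_pos hκ (Real.rpow_pos_of_pos (norm_pos_iff.2 hξ) α)
      have h1 : ((κ * ‖ξ‖ ^ α : ℝ) : ℂ) * (((κ * ‖ξ‖ ^ α)⁻¹ : ℝ) : ℂ) = 1 := by
        rw [← Complex.ofReal_mul, mul_inv_cancel₀ h0.ne', Complex.ofReal_one]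
      linear_combination (Complex.exp ((2 * Real.pi * inner ℝ ξ y : ℝ) * Complex.I) *
        (D ξ * E ξ)) * h1
  have hre : symFracLaplacian ((n : ℝ) + α) (SchwartzMap.postcompCLM Complex.reCLM ψ) y =
      (symFracLaplacian ((n : ℝ) + α) ψ y).re := by
    obtain ⟨M, hM, hd⟩ := ψ.exists_hasDecay ((n : ℝ) + α)
    have h := integral_re (hd.integrable_integrand hn hs hs2 hM y)
    rw [symFracLaplacian, symFracLaplacian]
    refine Eq.trans (integral_congr_ae (Eventually.of_forall fun z => ?_)) h
    simp [secondDiff, SchwartzMap.postcompCLM_apply]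
  rw [hre, hcomplex, Complex.sub_re, ← scaledKernel_eq_re_integral hR,
    ← scaledKernel_eq_re_integral hR']

end LowPass

/-! ### The Liouville theorem -/

section Liouville

variable {n : ℕ} {α : ℝ} {u : EuclideanSpace ℝ (Fin n) → ℝ}

theorem one_add_norm_inv_smul_rpow_neg_le {s R : ℝ} (hs : 0 ≤ s) (hR : 1 ≤ R)
    (y : EuclideanSpace ℝ (Fin n)) : (1 + ‖R⁻¹ • y‖) ^ (-s) ≤ R ^ s * (1 + ‖y‖) ^ (-s) := by
  have hR0 : 0 < R := by linarith
  have h : 1 + ‖y‖ ≤ R * (1 + ‖R⁻¹ • y‖) := by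
    rw [norm_smul, norm_inv, Real.norm_of_nonneg hR0.le, mul_add, mul_inv_cancel_left₀ hR0.ne']
    linarith
  have h2 : (1 + ‖y‖) ^ s ≤ R ^ s * (1 + ‖R⁻¹ • y‖) ^ s := by
    rw [← Real.mul_rpow hR0.le (by positivity)]
    exact Real.rpow_le_rpow (by positivity) h hs
  rw [Real.rpow_neg (by positivity), Real.rpow_neg (by positivity), ← div_eq_mul_inv,
    inv_eq_one_div, div_le_div_iff₀ (by positivity) (by positivity), one_mul]
  exact h2

/-- At a fixed scale, the translates of the kernel are dominated by the weight of `L_α`, locally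
uniformly in `x`. -/
theorem exists_abs_scaledKernel_sub_le (hα0 : 0 < α) {R : ℝ} (hR : 0 < R) : ∃ C, 0 ≤ C ∧
    ∀ x y : EuclideanSpace ℝ (Fin n), |scaledKernel R (y - x)| ≤
      C * (1 + ‖x‖) ^ ((n : ℝ) + α) * (1 + ‖y‖) ^ (-((n : ℝ) + α)) := by
  have hs : 0 ≤ (n : ℝ) + α := by positivity
  obtain ⟨M, hM, hK⟩ := (lowPassKernel n).exists_norm_iteratedFDeriv_le 0 ((n : ℝ) + α)
  refine ⟨(R ^ n)⁻¹ * (M * (max R 1) ^ ((n : ℝ) + α)), by positivity, fun x y => ?_⟩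
  have h := hK (R⁻¹ • (y - x))
  rw [norm_iteratedFDeriv_zero, Real.norm_eq_abs] at h
  have h1 := one_add_norm_inv_smul_rpow_neg_le hs (le_max_right R 1) (y - x)
  have h0 : (1 + ‖R⁻¹ • (y - x)‖) ^ (-((n : ℝ) + α)) ≤
      (1 + ‖(max R 1)⁻¹ • (y - x)‖) ^ (-((n : ℝ) + α)) := by
    refine Real.rpow_le_rpow_of_nonpos (by positivity) ?_ (by linarith)
    rw [norm_smul, norm_smul, norm_inv, norm_inv, Real.norm_of_nonneg hR.le,
      Real.norm_of_nonneg (by positivity)]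
    gcongr
    exact le_max_left R 1
  have h2 := one_add_norm_rpow_neg_le hs y (y - x)
  rw [sub_sub_cancel] at h2
  rw [scaledKernel, abs_mul, abs_of_pos (show 0 < (R ^ n)⁻¹ by positivity)]
  calc (R ^ n)⁻¹ * |lowPassKernel n (R⁻¹ • (y - x))|
      ≤ (R ^ n)⁻¹ * (M * ((max R 1) ^ ((n : ℝ) + α) *
        ((1 + ‖x‖) ^ ((n : ℝ) + α) * (1 + ‖y‖) ^ (-((n : ℝ) + α))))) := by
        refine mul_le_mul_of_nonneg_left (h.trans (mul_le_mul_of_nonneg_left ?_ hM))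
          (by positivity)
        exact h0.trans (h1.trans (mul_le_mul_of_nonneg_left h2 (by positivity)))
    _ = _ := by ring

theorem MemLAlpha.integrable_mul_of_weight_le (hα0 : 0 < α) (hu : MemLAlpha α u)
    {g : EuclideanSpace ℝ (Fin n) → ℝ} (hg : Continuous g) {C : ℝ}
    (hC : ∀ y, |g y| ≤ C * (1 + ‖y‖) ^ (-((n : ℝ) + α))) : Integrable fun y => u y * g y := by
  refine ((hu.integrable_mul_weight hα0).const_mul C).mono'
    (hu.1.mul hg.aestronglyMeasurable) (Eventually.of_forall fun y => ?_)
  rw [norm_mul, Real.norm_eq_abs, Real.norm_eq_abs]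
  calc |u y| * |g y| ≤ |u y| * (C * (1 + ‖y‖) ^ (-((n : ℝ) + α))) :=
        mul_le_mul_of_nonneg_left (hC y) (abs_nonneg _)
    _ = _ := by ring

theorem MemLAlpha.integrable_mul_scaledKernel (hα0 : 0 < α) (hu : MemLAlpha α u) {R : ℝ}
    (hR : 0 < R) (x : EuclideanSpace ℝ (Fin n)) :
    Integrable fun y => u y * scaledKernel R (y - x) := by
  obtain ⟨C, hC0, hC⟩ := exists_abs_scaledKernel_sub_le (n := n) hα0 hR
  exact hu.integrable_mul_of_weight_le hα0
    ((continuous_scaledKernel R).comp (continuous_id.sub continuous_const)) (hC x)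

theorem MemLAlpha.locallyIntegrable (hα0 : 0 < α) (hu : MemLAlpha α u) :
    LocallyIntegrable u := by
  have h1 : Integrable fun y => u y * (1 + ‖y‖) ^ (-((n : ℝ) + α)) := by
    refine hu.integrable_mul_of_weight_le hα0 (C := 1) ?_ fun y => ?_
    · exact Continuous.rpow_const (by fun_prop) fun y => Or.inl (by positivity)
    · rw [one_mul, abs_of_nonneg (by positivity)]
  have h2 : Continuous fun y : EuclideanSpace ℝ (Fin n) => (1 + ‖y‖) ^ ((n : ℝ) + α) :=
    Continuous.rpow_const (by fun_prop) fun y => Or.inl (by positivity)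
  refine (h1.locallyIntegrable.mul_continuous h2).congr (Eventually.of_forall fun y => ?_)
  change u y * (1 + ‖y‖) ^ (-((n : ℝ) + α)) * (1 + ‖y‖) ^ ((n : ℝ) + α) = u y
  rw [mul_assoc, ← Real.rpow_add (by positivity), neg_add_cancel, Real.rpow_zero, mul_one]

/-- The low-frequency part of `u` at scale `R`. -/
noncomputable def lowPass (u : EuclideanSpace ℝ (Fin n) → ℝ) (R : ℝ)
    (x : EuclideanSpace ℝ (Fin n)) : ℝ :=
  ∫ y, u y * scaledKernel R (y - x)

/-- The low-frequency part of an `α`-harmonic function does not depend on the scale. -/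
theorem IsAlphaHarmonic.lowPass_eq (hn : 1 ≤ n) (hα0 : 0 < α) (hα2 : α < 2)
    (hu : IsAlphaHarmonic α u) {R R' : ℝ} (hR : 0 < R) (hR' : 0 < R') :
    lowPass u R = lowPass u R' := by
  ext x
  obtain ⟨f, hf⟩ := exists_symFracLaplacian_eq_scaledKernel_sub hn hα0 hα2 hR hR' x
  have h := hu.integral_mul_symFracLaplacian_eq_zero hn hα0 hα2 f
  simp_rw [hf, mul_sub] at h
  rw [integral_sub (hu.1.integrable_mul_scaledKernel hα0 hR x)
    (hu.1.integrable_mul_scaledKernel hα0 hR' x)] at h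
  exact sub_eq_zero.1 h

theorem continuous_lowPass (hα0 : 0 < α) (hu : MemLAlpha α u) {R : ℝ} (hR : 0 < R) :
    Continuous (lowPass u R) := by
  obtain ⟨C, hC0, hC⟩ := exists_abs_scaledKernel_sub_le (n := n) hα0 hR
  rw [continuous_iff_continuousAt]
  intro x₀
  have hc : Continuous fun x : EuclideanSpace ℝ (Fin n) => (1 + ‖x‖) ^ ((n : ℝ) + α) :=
    Continuous.rpow_const (by fun_prop) fun y => Or.inl (by positivity)
  have hK := continuous_scaledKernel (n := n) R
  refine tendsto_integral_mul_of_weight_le hα0 hu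
    (C * ((1 + ‖x₀‖) ^ ((n : ℝ) + α) + 1))
    (Eventually.of_forall fun x => Continuous.aestronglyMeasurable (by fun_prop)) ?_ fun y => ?_
  · filter_upwards [hc.continuousAt.eventually_lt_const
      (show (1 + ‖x₀‖) ^ ((n : ℝ) + α) < (1 + ‖x₀‖) ^ ((n : ℝ) + α) + 1 by linarith)] with x hx y
    refine (hC x y).trans (mul_le_mul_of_nonneg_right
      (mul_le_mul_of_nonneg_left hx.le hC0) (by positivity))
  · have : Continuous fun x => scaledKernel R (y - x) := by fun_prop
    exact this.tendsto x₀

/-- At scale `R` the second difference of the low-frequency part is `O(R^(α - 2))`. -/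
theorem exists_abs_secondDiff_lowPass_le (hα0 : 0 < α) (hu : MemLAlpha α u)
    (x h : EuclideanSpace ℝ (Fin n)) :
    ∃ C, ∀ R, 1 ≤ R → |secondDiff (lowPass u R) x h| ≤ C * R ^ (α - 2) := by
  have hs : 0 ≤ (n : ℝ) + α := by positivity
  obtain ⟨M, hM, hK⟩ := (lowPassKernel n).exists_norm_iteratedFDeriv_le 2 ((n : ℝ) + α)
  set ρ := ‖x‖ + ‖h‖ with hρ
  refine ⟨∫ y, M * (1 + ρ) ^ ((n : ℝ) + α) * ‖h‖ ^ 2 *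
    (|u y| * (1 + ‖y‖) ^ (-((n : ℝ) + α))), fun R hR => ?_⟩
  have hR0 : 0 < R := by linarith
  have hRi : R⁻¹ ≤ 1 := inv_le_one_of_one_le₀ hR
  have hsd : secondDiff (lowPass u R) x h =
      ∫ y, u y * ((R ^ n)⁻¹ * secondDiff (lowPassKernel n) (R⁻¹ • (y - x)) (R⁻¹ • h)) := by
    have hI := hu.integrable_mul_scaledKernel hα0 hR0
    simp only [secondDiff, lowPass, smul_eq_mul]
    have hI2 : Integrable fun y => 2 * (u y * scaledKernel R (y - x)) -
        u y * scaledKernel R (y - (x + h)) := ((hI x).const_mul 2).sub (hI (x + h))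
    rw [← integral_const_mul, ← integral_sub ((hI x).const_mul 2) (hI (x + h)),
      ← integral_sub hI2 (hI (x - h))]
    refine integral_congr_ae (Eventually.of_forall fun y => ?_)
    simp only [scaledKernel, ← smul_add, ← smul_sub]
    rw [show y - (x + h) = y - x - h by abel, show y - (x - h) = y - x + h by abel]
    ring
  rw [hsd, ← integral_mul_const, ← Real.norm_eq_abs]
  refine norm_integral_le_of_norm_le (((hu.integrable_mul_weight hα0).const_mul _).mul_const _)
    (Eventually.of_forall fun y => ?_)
  have hbound : ∀ w ∈ Metric.closedBall (R⁻¹ • (y - x)) ‖R⁻¹ • h‖,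
      ‖iteratedFDeriv ℝ 2 (lowPassKernel n) w‖ ≤
        M * ((1 + ρ) ^ ((n : ℝ) + α) * (R ^ ((n : ℝ) + α) *
          (1 + ‖y‖) ^ (-((n : ℝ) + α)))) := by
    intro w hw
    refine (hK w).trans (mul_le_mul_of_nonneg_left ?_ hM)
    refine (one_add_norm_rpow_neg_le hs (R⁻¹ • y) w).trans ?_
    refine mul_le_mul (Real.rpow_le_rpow (by positivity) ?_ hs)
      (one_add_norm_inv_smul_rpow_neg_le hs hR y) (by positivity) (by positivity)
    rw [Metric.mem_closedBall, dist_comm, dist_eq_norm] at hw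
    have e : R⁻¹ • y - w = R⁻¹ • x + (R⁻¹ • (y - x) - w) := by rw [smul_sub]; abel
    have h1 : ‖R⁻¹ • x‖ ≤ ‖x‖ := by
      rw [norm_smul, Real.norm_of_nonneg (by positivity)]
      exact mul_le_of_le_one_left (norm_nonneg x) hRi
    have h2 : ‖R⁻¹ • h‖ ≤ ‖h‖ := by
      rw [norm_smul, Real.norm_of_nonneg (by positivity)]
      exact mul_le_of_le_one_left (norm_nonneg h) hRi
    have h3 := norm_add_le (R⁻¹ • x) (R⁻¹ • (y - x) - w)
    rw [← e] at h3
    linarith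
  have hd := norm_secondDiff_le ((lowPassKernel n).smooth 2) hbound
  rw [norm_mul, norm_mul, Real.norm_eq_abs (u y), Real.norm_of_nonneg
    (show 0 ≤ (R ^ n)⁻¹ by positivity)]
  calc |u y| * ((R ^ n)⁻¹ * ‖secondDiff (lowPassKernel n) (R⁻¹ • (y - x)) (R⁻¹ • h)‖)
      ≤ |u y| * ((R ^ n)⁻¹ * (M * ((1 + ρ) ^ ((n : ℝ) + α) * (R ^ ((n : ℝ) + α) *
          (1 + ‖y‖) ^ (-((n : ℝ) + α)))) * ‖R⁻¹ • h‖ ^ 2)) :=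
        mul_le_mul_of_nonneg_left (mul_le_mul_of_nonneg_left hd (by positivity)) (abs_nonneg _)
    _ = _ := by
        rw [norm_smul, norm_inv, Real.norm_of_nonneg hR0.le, Real.rpow_add hR0,
          Real.rpow_sub hR0, Real.rpow_natCast, Real.rpow_two]
        field_simp

theorem IsAlphaHarmonic.secondDiff_lowPass (hn : 1 ≤ n) (hα0 : 0 < α) (hα2 : α < 2)
    (hu : IsAlphaHarmonic α u) (x h : EuclideanSpace ℝ (Fin n)) :
    secondDiff (lowPass u 1) x h = 0 := by
  obtain ⟨C, hC⟩ := exists_abs_secondDiff_lowPass_le hα0 hu.1 x h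
  have hlim : Tendsto (fun R : ℝ => C * R ^ (α - 2)) atTop (𝓝 0) := by
    have := (tendsto_rpow_neg_atTop (show 0 < 2 - α by linarith)).const_mul C
    simpa only [mul_zero, neg_sub] using this
  have hle : |secondDiff (lowPass u 1) x h| ≤ 0 := by
    refine ge_of_tendsto hlim ?_
    filter_upwards [eventually_ge_atTop 1] with R hR
    rw [hu.lowPass_eq hn hα0 hα2 one_pos (show 0 < R by linarith)]
    exact hC R hR
  exact abs_nonpos_iff.1 hle

theorem IsAlphaHarmonic.exists_lowPass_eq_affine (hn : 1 ≤ n) (hα0 : 0 < α) (hα2 : α < 2)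
    (hu : IsAlphaHarmonic α u) : ∃ (a : ℝ) (b : EuclideanSpace ℝ (Fin n)),
      ∀ x, lowPass u 1 x = a + inner ℝ b x := by
  have hmid : ∀ x y, lowPass u 1 (midpoint ℝ x y) =
      midpoint ℝ (lowPass u 1 x) (lowPass u 1 y) := by
    intro x y
    have h := hu.secondDiff_lowPass hn hα0 hα2 (midpoint ℝ x y) (y - midpoint ℝ x y)
    have e : midpoint ℝ x y - (y - midpoint ℝ x y) = x := by
      have := midpoint_add_self ℝ x y
      rw [sub_sub_eq_add_sub, this, add_sub_cancel_right]
    rw [secondDiff, add_sub_cancel, e, smul_eq_mul] at h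
    rw [midpoint_eq_smul_add ℝ (lowPass u 1 x), smul_eq_mul, invOf_eq_inv]
    linarith
  let A : EuclideanSpace ℝ (Fin n) →ᵃ[ℝ] ℝ :=
    AffineMap.ofMapMidpoint (lowPass u 1) hmid (continuous_lowPass hα0 hu.1 one_pos)
  have hA : ∀ x, A x = lowPass u 1 x := fun x => rfl
  refine ⟨A 0, (InnerProductSpace.toDual ℝ (EuclideanSpace ℝ (Fin n))).symm
    (LinearMap.toContinuousLinearMap A.linear), fun x => ?_⟩
  rw [InnerProductSpace.toDual_symm_apply, LinearMap.coe_toContinuousLinearMap', ← hA x]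
  have := congrFun (A.decomp) x
  rw [this]
  simp [add_comm]

/-- As `R → 0` the low-frequency part converges to `u` in the sense of distributions. -/
theorem tendsto_integral_mul_lowPass (hα0 : 0 < α) (hu : MemLAlpha α u)
    {g : EuclideanSpace ℝ (Fin n) → ℝ} (hg : ContDiff ℝ ∞ g) (hgc : HasCompactSupport g) :
    Tendsto (fun R => ∫ x, g x * lowPass u R x) (𝓝[>] 0) (𝓝 (∫ x, u x * g x)) := by
  have hs : 0 ≤ (n : ℝ) + α := by positivity
  have hK := (lowPassKernel n).continuous
  have hgcont := hg.continuous
  -- exchanging the order of integration moves the mollification onto `g`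
  have hswap : ∀ R : ℝ, 0 < R → ∫ x, g x * lowPass u R x =
      ∫ y, u y * ∫ w, g (y - R • w) * lowPassKernel n w := by
    intro R hR
    obtain ⟨C, hC0, hC⟩ := exists_abs_scaledKernel_sub_le (n := n) hα0 hR
    have hcK := continuous_scaledKernel (n := n) R
    have hcw : Continuous fun x : EuclideanSpace ℝ (Fin n) => (1 + ‖x‖) ^ ((n : ℝ) + α) :=
      Continuous.rpow_const (by fun_prop) fun y => Or.inl (by positivity)
    have hgw : Integrable fun x => ‖g x‖ * (1 + ‖x‖) ^ ((n : ℝ) + α) :=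
      Continuous.integrable_of_hasCompactSupport (by fun_prop) hgc.norm.mul_right
    have hF : Integrable (Function.uncurry fun x y => g x * (u y * scaledKernel R (y - x)))
        (volume.prod volume) := by
      refine ((hgw.mul_prod (hu.integrable_mul_weight hα0)).const_mul C).mono' ?_
        (Eventually.of_forall fun q => ?_)
      · refine AEStronglyMeasurable.mul ?_ (AEStronglyMeasurable.mul hu.1.comp_snd ?_)
        · exact Continuous.aestronglyMeasurable (by fun_prop)
        · exact Continuous.aestronglyMeasurable (by fun_prop)
      · simp only [Function.uncurry]
        rw [norm_mul, norm_mul, Real.norm_eq_abs (u q.2)]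
        calc _ ≤ ‖g q.1‖ * (|u q.2| * (C * (1 + ‖q.1‖) ^ ((n : ℝ) + α) *
              (1 + ‖q.2‖) ^ (-((n : ℝ) + α)))) :=
              mul_le_mul_of_nonneg_left (mul_le_mul_of_nonneg_left (hC q.1 q.2)
                (abs_nonneg _)) (norm_nonneg _)
          _ = _ := by ring
    simp_rw [lowPass, ← integral_const_mul]
    rw [integral_integral_swap hF]
    refine integral_congr_ae (Eventually.of_forall fun y => ?_)
    simp only
    -- the substitution `x = y - R w`
    have h1 := Measure.integral_comp_smul (volume : Measure (EuclideanSpace ℝ (Fin n)))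
      (fun x => g (y - x) * lowPassKernel n (R⁻¹ • x)) R
    simp only [inv_smul_smul₀ hR.ne'] at h1
    rw [finrank_euclideanSpace_fin, abs_of_pos (by positivity), smul_eq_mul] at h1
    rw [integral_const_mul, h1, ← integral_sub_left_eq_self _ volume y, ← integral_const_mul,
      ← integral_const_mul]
    refine integral_congr_ae (Eventually.of_forall fun x => ?_)
    simp only [scaledKernel, sub_sub_cancel]
    ring
  obtain ⟨M, hM, hgM⟩ := (hgc.toSchwartzMap hg).exists_norm_iteratedFDeriv_le 0 ((n : ℝ) + α)
  have hgM' : ∀ y, |g y| ≤ M * (1 + ‖y‖) ^ (-((n : ℝ) + α)) := by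
    intro y
    have := hgM y
    rwa [norm_iteratedFDeriv_zero] at this
  have hB : Integrable fun w => (1 + ‖w‖) ^ ((n : ℝ) + α) * |lowPassKernel n w| := by
    obtain ⟨M', hM', hKM⟩ := (lowPassKernel n).exists_norm_iteratedFDeriv_le 0
      ((n : ℝ) + α + (n + 1))
    refine ((integrable_one_add_norm_rpow (n := n) (s := (n : ℝ) + 1) (by linarith)).const_mul
      M').mono' (Measurable.aestronglyMeasurable (by fun_prop)) (Eventually.of_forall fun w => ?_)
    have h := hKM w
    rw [norm_iteratedFDeriv_zero, Real.norm_eq_abs] at h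
    rw [Real.norm_of_nonneg (by positivity)]
    calc _ ≤ (1 + ‖w‖) ^ ((n : ℝ) + α) * (M' * (1 + ‖w‖) ^ (-((n : ℝ) + α + (n + 1)))) :=
          mul_le_mul_of_nonneg_left h (by positivity)
      _ = _ := by
          rw [show -((n : ℝ) + 1) = ((n : ℝ) + α) + -((n : ℝ) + α + (n + 1)) by ring,
            Real.rpow_add (by positivity) ((n : ℝ) + α), mul_left_comm]
  have hlim : Tendsto (fun R : ℝ => ∫ y, u y * ∫ w, g (y - R • w) * lowPassKernel n w) (𝓝[>] 0)
      (𝓝 (∫ x, u x * g x)) := by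
    refine tendsto_integral_mul_of_weight_le hα0 hu
      (M * ∫ w, (1 + ‖w‖) ^ ((n : ℝ) + α) * |lowPassKernel n w|)
      (Eventually.of_forall fun R => ?_) ?_ fun y => ?_
    · exact AEStronglyMeasurable.integral_prod_right' (μ := volume) (ν := volume)
        (f := fun p : EuclideanSpace ℝ (Fin n) × EuclideanSpace ℝ (Fin n) =>
          g (p.1 - R • p.2) * lowPassKernel n p.2)
        (Continuous.aestronglyMeasurable (by fun_prop))
    · filter_upwards [Ioo_mem_nhdsGT zero_lt_one] with R hR y
      rw [mul_right_comm, ← integral_const_mul, ← Real.norm_eq_abs]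
      refine norm_integral_le_of_norm_le (hB.const_mul _) (Eventually.of_forall fun w => ?_)
      have h1 := one_add_norm_rpow_neg_le hs y (y - R • w)
      rw [sub_sub_cancel] at h1
      have h2 : (1 + ‖R • w‖) ^ ((n : ℝ) + α) ≤ (1 + ‖w‖) ^ ((n : ℝ) + α) := by
        refine Real.rpow_le_rpow (by positivity) ?_ hs
        rw [norm_smul, Real.norm_of_nonneg hR.1.le]
        linarith [mul_le_of_le_one_left (norm_nonneg w) hR.2.le]
      rw [norm_mul, Real.norm_eq_abs, Real.norm_eq_abs]
      calc |g (y - R • w)| * |lowPassKernel n w|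
          ≤ (M * ((1 + ‖w‖) ^ ((n : ℝ) + α) * (1 + ‖y‖) ^ (-((n : ℝ) + α)))) *
              |lowPassKernel n w| := by
            refine mul_le_mul_of_nonneg_right ((hgM' _).trans (mul_le_mul_of_nonneg_left
              (h1.trans (mul_le_mul_of_nonneg_right h2 (by positivity))) hM)) (abs_nonneg _)
        _ = _ := by ring
    · have hone : ∫ w, g y * lowPassKernel n w = g y := by
        rw [integral_const_mul, integral_lowPassKernel, mul_one]
      rw [show 𝓝 (g y) = 𝓝 (∫ w, g y * lowPassKernel n w) by rw [hone]]
      refine tendsto_integral_filter_of_dominated_convergence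
        (fun w => M * |lowPassKernel n w|)
        (Eventually.of_forall fun R => Continuous.aestronglyMeasurable (by fun_prop))
        (Eventually.of_forall fun R => Eventually.of_forall fun w => ?_)
        ((lowPassKernel n).integrable.abs.const_mul M) (Eventually.of_forall fun w => ?_)
      · rw [norm_mul]
        refine mul_le_mul_of_nonneg_right ((hgM' _).trans (mul_le_of_le_one_right hM
          (Real.rpow_le_one_of_one_le_of_nonpos ?_ (by linarith)))) (norm_nonneg _)
        linarith [norm_nonneg (y - R • w)]
      · have hc : Continuous fun R : ℝ => g (y - R • w) * lowPassKernel n w := by fun_prop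
        have := hc.tendsto 0
        simp only [zero_smul, sub_zero] at this
        exact this.mono_left nhdsWithin_le_nhds
  refine hlim.congr' ?_
  filter_upwards [self_mem_nhdsWithin] with R hR
  exact (hswap R hR).symm

/-- **Liouville theorem** for `α`-harmonic functions in the sense of distributions. -/
theorem IsAlphaHarmonic.ae_eq_affine (hn : 1 ≤ n) (hα0 : 0 < α) (hα2 : α < 2)
    (hu : IsAlphaHarmonic α u) :
    ∃ (a : ℝ) (b : EuclideanSpace ℝ (Fin n)), ∀ᵐ x, u x = a + inner ℝ b x := by
  obtain ⟨a, b, hab⟩ := hu.exists_lowPass_eq_affine hn hα0 hα2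
  refine ⟨a, b, ?_⟩
  have hae : ∀ᵐ x, u x = lowPass u 1 x := by
    refine ae_eq_of_integral_contDiff_smul_eq (hu.1.locallyIntegrable hα0)
      (continuous_lowPass hα0 hu.1 one_pos).locallyIntegrable fun g hg hgc => ?_
    have h1 := tendsto_integral_mul_lowPass hα0 hu.1 hg hgc
    have h2 : Tendsto (fun R => ∫ x, g x * lowPass u R x) (𝓝[>] 0)
        (𝓝 (∫ x, g x * lowPass u 1 x)) := by
      refine tendsto_const_nhds.congr' ?_
      filter_upwards [self_mem_nhdsWithin] with R hR
      rw [hu.lowPass_eq hn hα0 hα2 one_pos hR]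
    simp only [smul_eq_mul]
    rw [← tendsto_nhds_unique h1 h2]
    simp_rw [mul_comm]
  filter_upwards [hae] with x hx
  rw [hx, hab]

end Liouville

/-! ### The Poisson representation -/

theorem mainTheorem3 (n : ℕ) (hn : 1 ≤ n) (α : ℝ) (hα0 : 0 < α) (hα2 : α < 2)
    (u : EuclideanSpace ℝ (Fin n) → ℝ) (hu : IsAlphaHarmonic α u) (r : ℝ) (hr : 0 < r) :
    -- the Poisson integral converges absolutely at every point of the ball
    (∀ x : EuclideanSpace ℝ (Fin n), ‖x‖ < r →
      IntegrableOn (fun y => fracPoissonKernel α r y x * u y) {y | r < ‖y‖} volume) ∧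
    -- `û` is `α`-harmonic in the ball, in the sense of distributions and pointwise
    IsAlphaHarmonicOn α (fracPoissonExtension α r u) (Metric.ball 0 r) ∧
    (∀ x : EuclideanSpace ℝ (Fin n), ‖x‖ < r →
      HasFracLaplacianAt α (fracPoissonExtension α r u) x 0) ∧
    -- the Poisson representation: almost everywhere, and wherever `u` is continuous
    (∀ᵐ x : EuclideanSpace ℝ (Fin n), ‖x‖ < r →
      u x = ∫ y in {y | r < ‖y‖}, fracPoissonKernel α r y x * u y) ∧
    (∀ x : EuclideanSpace ℝ (Fin n), ‖x‖ < r → ContinuousAt u x →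
      u x = ∫ y in {y | r < ‖y‖}, fracPoissonKernel α r y x * u y) := by
  obtain ⟨a, b, h⟩ := hu.ae_eq_affine hn hα0 hα2
  have hrep : ∀ x : EuclideanSpace ℝ (Fin n), ‖x‖ < r →
      ∫ y in {y | r < ‖y‖}, fracPoissonKernel α r y x * u y = a + inner ℝ b x := fun x hx =>
    setIntegral_fracPoissonKernel_mul hn hα0 hα2 hr hx hu.1 h
  have hin : ∀ x : EuclideanSpace ℝ (Fin n), ‖x‖ < r →
      fracPoissonExtension α r u x = a + inner ℝ b x := fun x hx => by
    rw [fracPoissonExtension, if_pos hx, hrep x hx]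
  have hext : fracPoissonExtension α r u =ᵐ[volume] u := by
    filter_upwards [h] with x hx
    by_cases hxr : ‖x‖ < r
    · rw [hin x hxr, hx]
    · rw [fracPoissonExtension, if_neg hxr]
  have hmem : MemLAlpha α (fracPoissonExtension α r u) := by
    refine ⟨hu.1.1.congr hext.symm, hu.1.2.congr ?_⟩
    filter_upwards [hext] with x hx
    rw [hx]
  refine ⟨fun x hx => (integrable_fracPoissonKernel_mul hn hα0 hα2 hr hx hu.1 h).integrableOn,
    ⟨hmem, fun φ hφ hφc _ => ?_⟩, fun x hx => ?_, ?_, fun x hx hc => ?_⟩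
  · rw [← hu.2 φ hφ hφc (Set.subset_univ _)]
    refine integral_congr_ae ?_
    filter_upwards [hext] with x hx
    rw [hx]
  · exact hasFracLaplacianAt_of_ae_affine hα0 hmem (hext.trans h) (hin x hx)
  · filter_upwards [h] with x hx hxr
    rw [hrep x hxr, hx]
  · rw [hrep x hx]
    exact eq_affine_of_continuousAt h hc
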